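/- **Notation.** Let $m$ be a prime power, $\mathbb{F}_m$ the field with $m$ elements, and let $d\le m$, $n=dm$. Identify $[d]$ with $d$ distinct elements of $\mathbb{F}_m$ and index the $n$ variables $x_{i,a}$ by $i\in[d]$, $a\in\mathbb{F}_m$. The Nisan–Wigderson polynomial is $$\mathsf{NW}_{d,m,e}(\mathbf{x})=\sum_{p\in\mathbb{F}_m[t],\ \deg p<e} x_{1,p(1)}\cdots x_{d,p(d)} .$$ For a finite field $\mathbb{F}_q$, $S\subseteq\mathbb{F}_q^n$ and $P\in\mathbb{F}_q[\mathbf{x}]$, let $\Lambda_{k,\ell,S}(P)$ be the matrix with rows indexed by pairs of a derivative $\partial_{\mathbf{x}^\alpha}$ of order $k$ and a monomial $\mathbf{x}^\beta$ of degree $\ell$, with columns indexed by the points $\mathbf a\in S$, and with entries $(\mathbf{x}^\beta\cdot\partial_{\mathbf{x}^\alpha}P)(\mathbf a)$. Let $\Gamma_{k,\ell,S}(P)$ be the dimension over $\mathbb{F}_q$ of the span of the evaluation vectors on $S$ of all the polynomials $\mathbf{x}^\beta\cdot\partial_{\mathbf{x}^\alpha}P$ with $\deg\mathbf x^\beta=\ell$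 and $\partial_{\mathbf{x}^\alpha}$ of order $k$. **Parameters.** For a constant $A>0$, call $(d,m,e,k,\ell,\epsilon)$, with $d,m,e,k,\ell$ natural numbers and $\epsilon$ real, *$A$-admissible* if, with $n=dm$, - $d^2/A\le m\le A d^2$, $\ k\le A\sqrt d$, $\ \frac1A\cdot\frac{\log d}{\sqrt d}\le\epsilon\le A\cdot\frac{\log d}{\sqrt d}$, - $m^k\ge(1+\epsilon)^{2(d-k)}$, - $m^{-A}\left(\frac{2}{1+\epsilon}\right)^{d-k}\le m^{e-k}\le m^{A}\left(\frac{2}{1+\epsilon}\right)^{d-k}$, - $\ell=\left\lfloor\frac n2(1-\epsilon)\right\rfloor$. **Statement.** For every $A>0$ there is a constant $C>0$, depending only on $A$, such that the following holds. Let $\delta(d)=\exp(-g(d))$ with $g(d)/\log^2 d\to\infty$, that is, $\delta=\exp(-\omega(\log^2 d))$. Then there is $d_0$ such that for all $d\ge d_0$, all $A$-admissible $(d,m,e,k,\ell,\epsilon)$ with $m$ a prime power and $d\le m$, every finite field $\mathbb{F}_q$ and every $\mathcal{E}\subseteq\mathbb{F}_q^n$ with $|\mathcal{E}|\le\delta(d)\,q^n$,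 there exist $\mathbf c\in\mathbb{F}_q^n$ and a set $S\subseteq(\mathbf c+\{0,1\}^n)\setminus\mathcal{E}$ with $$\operatorname{rank}\Lambda_{k,\ell,S}(\mathsf{NW}_{d,m,e})\ \ge\ \binom{n}{\ell+d-k}\exp(-C\log^2 d) \quad\text{and}\quad \Gamma_{k,\ell,S}(\mathsf{NW}_{d,m,e})\ \ge\ \binom{n}{\ell+d-k}\exp(-C\log^2 d).$$ -/

import Mathlib

open MvPolynomial

/-- Formal partial derivatives commute. -/
theorem pderiv_left_comm {σ F : Type*} [CommRing F] (i j : σ) (P : MvPolynomial σ F) :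
    pderiv i (pderiv j P) = pderiv j (pderiv i P) := by
  have h : ⁅(pderiv i : Derivation F (MvPolynomial σ F) (MvPolynomial σ F)),
      (pderiv j : Derivation F (MvPolynomial σ F) (MvPolynomial σ F))⁆ = 0 := by
    classical
    apply MvPolynomial.derivation_ext
    intro l
    rw [Derivation.commutator_apply]
    simp only [pderiv_X, Pi.single_apply]
    split_ifs <;> simp
  have h2 := congrArg (fun D : Derivation F (MvPolynomial σ F) (MvPolynomial σ F) => D P) h
  simpa [Derivation.commutator_apply, sub_eq_zero] using h2

instance pderivLeftCommutative {σ F : Type*} [CommRing F] :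
    LeftCommutative (fun (i : σ) (Q : MvPolynomial σ F) => pderiv i Q) :=
  ⟨fun i j Q => pderiv_left_comm i j Q⟩

/-- The iterated formal partial derivative `∂_{x^α} P`: differentiate `α i` times with respect to
the variable `x_i`, for every `i`. Its order is `α.degree`. -/
noncomputable def partialDeriv {σ F : Type*} [CommRing F] (α : σ →₀ ℕ) (P : MvPolynomial σ F) :
    MvPolynomial σ F :=
  Multiset.foldr (fun i Q => pderiv i Q) P (Finsupp.toMultiset α)

/-- The shifted partial derivatives `x^{=ℓ} ∂^{=k}(P)`: all polynomials `x^β · ∂_{x^α} P` with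
`deg x^β = ℓ` and `∂_{x^α}` of order `k`. -/
def shiftedPartials {σ F : Type*} [CommRing F] (k ℓ : ℕ) (P : MvPolynomial σ F) :
    Set (MvPolynomial σ F) :=
  {Q | ∃ α β : σ →₀ ℕ, α.degree = k ∧ β.degree = ℓ ∧ Q = monomial β 1 * partialDeriv α P}

/-- `Eval_S(P)`: the vector of the evaluations of `P` at the points of `S`. -/
noncomputable def evalVec {σ F : Type*} [CommRing F] (S : Finset (σ → F)) (P : MvPolynomial σ F) :
    S → F :=
  fun a => MvPolynomial.eval a.1 P

/-- The complexity measure `Γ_{k,ℓ,S}(P) = Dim (Eval_S (x^{=ℓ} ∂^{=k}(P)))`. -/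
noncomputable def Gam {σ F : Type*} [Field F] (k ℓ : ℕ) (S : Finset (σ → F))
    (P : MvPolynomial σ F) : ℕ :=
  Module.finrank F (Submodule.span F (evalVec S '' shiftedPartials k ℓ P))

/-- The evaluation matrix `Λ(P)`: its rows are indexed by a derivative `∂_{x^α}` of order `k` and a
monomial `x^β` of degree `ℓ`, its columns by the points of `S`, and its entries are the
values `(x^β · ∂_{x^α} P)(a)`. -/
noncomputable def evalMatrix {σ F : Type*} [Field F] (k ℓ : ℕ) (S : Finset (σ → F))
    (P : MvPolynomial σ F) :
    Matrix ({α : σ →₀ ℕ // α.degree = k} × {β : σ →₀ ℕ // β.degree = ℓ}) S F :=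
  Matrix.of fun r a => MvPolynomial.eval a.1 (monomial r.2.1 1 * partialDeriv r.1.1 P)

/-- There are finitely many univariate polynomials of degree less than `e` over a finite field. -/
noncomputable instance degreeLTFintype {K : Type*} [Field K] [Fintype K] (e : ℕ) :
    Fintype (Polynomial.degreeLT K e) :=
  Fintype.ofEquiv (Fin e → K) (Polynomial.degreeLTEquiv K e).symm.toEquiv

/-- The Nisan-Wigderson polynomial `NW_{d,m,e}`, with coefficients in `F`. Here `K` is the field with
`m` elements, which serves as the second index set of the `n = d * m` variables, and
`pt` places the index set `[d]` inside `K`. It is the sum, over all `p ∈ K[t]` of degree less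
than `e`, of the monomials `∏ i, x_{i, p(i)}`. -/
noncomputable def NW (F : Type*) [CommRing F] {K : Type*} [Field K] [Fintype K] {d : ℕ}
    (pt : Fin d ↪ K) (e : ℕ) : MvPolynomial (Fin d × K) F :=
  ∑ p : Polynomial.degreeLT K e, ∏ i : Fin d, X (i, (p : Polynomial K).eval (pt i))

/-- The Boolean hypercube `{0,1}^n ⊆ F^n`. -/
def hypercube (σ F : Type*) [Field F] : Set (σ → F) :=
  {x | ∀ i, x i = 0 ∨ x i = 1}

/-- The constraints on the parameters, with all implicit constants (those of `Θ(·)`, `O(·)`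
and `poly(·)`) bounded in terms of `A`:
`m = Θ(d²)`, `k = O(√d)`, `ε = Θ(log d / √d)`, `m^k ≥ (1+ε)^{2(d-k)}`,
`m^{e-k} = (2/(1+ε))^{d-k} · poly(m)` (that is, up to a factor between `m^{-A}` and `m^A`), and
`ℓ = (n/2)(1-ε)`, rounded down to an integer, where `n = d * m`. All powers have real exponents. -/
structure NWParams (A : ℝ) (d m e k ℓ : ℕ) (ε : ℝ) : Prop where
  m_lower : (d : ℝ) ^ 2 / A ≤ m
  m_upper : (m : ℝ) ≤ A * (d : ℝ) ^ 2
  k_upper : (k : ℝ) ≤ A * √(d : ℝ)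
  ε_lower : Real.log d / √(d : ℝ) / A ≤ ε
  ε_upper : ε ≤ A * (Real.log d / √(d : ℝ))
  pow_k : (1 + ε) ^ (2 * ((d : ℝ) - k)) ≤ (m : ℝ) ^ (k : ℝ)
  pow_e_lower : (m : ℝ) ^ (-A) * (2 / (1 + ε)) ^ ((d : ℝ) - k) ≤ (m : ℝ) ^ ((e : ℝ) - k)
  pow_e_upper : (m : ℝ) ^ ((e : ℝ) - k) ≤ (m : ℝ) ^ A * (2 / (1 + ε)) ^ ((d : ℝ) - k)
  shift : ℓ = ⌊((d * m : ℕ) : ℝ) / 2 * (1 - ε)⌋₊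

/-! Put `n = d * m`, `t = d - k`, `D = ℓ + t`. Fix the set `I` of the first `k` indices.
Differentiating along the graph over `I` of a polynomial `q₀` leaves the sum, over the class of all
`q` agreeing with `q₀` on `I`, of the monomials of the graphs of `q` over `Iᶜ`. Multiply by the
multilinear monomial of an `ℓ`-set `b`. The multilinear terms that remain are the `b ∪ graphOver Iᶜ
(f q)` with `b` disjoint from the graph, and the largest of them under an arbitrary injective
ranking `r` serves as leading monomial.

Algebra (`card_le_finrank_span_add`): for a polynomial of degree at most `D`, an iterated finite
difference at any base point `c` reads off the coefficient of a multilinear monomial of degree `D`;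
it kills lower terms and non-multilinear ones. A combination of polynomials with distinct leading
monomials therefore cannot vanish on the whole Hamming ball of radius `D` around `c`. Deleting `#B`
points of the ball costs at most `#B` in rank. This holds over every field.

Counting (`IsInterpolating.exists_leading`): let `Ω` be the set of pairs (class, `b`) in which some
graph of the class avoids `b`. Polynomials of bounded degree are nearly pairwise independent, so
Cauchy–Schwarz within each class shows that `Ω` is large. Each pair yields a leading monomial
containing the graph of some `q`, and a second use of Cauchy–Schwarz shows that few leading
monomials cannot absorb all the pairs. The expected counts are `μ = m^(e-k) u^t`, the graphs in a
class that avoid a random `b`, and `M = m^e w^t`, the graphs inside a random `D`-set, where `u` is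
about `(1+ε)/2` and `w` about `(1-ε)/2`. The parameters give `μ ≤ 2 m^A` and `M ≥ m^(-A) (1-ε²)^t`;
as `ε² d = O(log² d)`, only a factor `exp(O(log² d))` is lost.

Deletion (`exists_translate`): averaging over `c`, some ball meets the bad set in at most `δ (D+1)
(n choose D)` points, which is negligible for `δ = exp(-ω(log² d))`. -/

/-! ### Finite differences and leading multilinear monomials. -/

/-- The vector `1_s`: it is `1` on `s` and `0` elsewhere. -/
noncomputable def indicatorVec {σ : Type*} (F : Type*) [Zero F] [One F] (s : Finset σ) : σ → F :=
  Set.indicator (s : Set σ) 1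

/-- The exponent of the multilinear monomial with support `s`. -/
noncomputable def multilinearExp {σ : Type*} (s : Finset σ) : σ →₀ ℕ :=
  Finsupp.indicator s fun _ _ => 1

theorem multilinearExp_apply {σ : Type*} [DecidableEq σ] (s : Finset σ) (i : σ) :
    multilinearExp s i = if i ∈ s then 1 else 0 := by
  simp [multilinearExp, Finsupp.indicator_apply]

theorem degree_multilinearExp {σ : Type*} (s : Finset σ) : (multilinearExp s).degree = s.card := by
  classical
  have h : (multilinearExp s).support = s := by
    ext i; simp [multilinearExp_apply]
  rw [Finsupp.degree_apply, h, Finset.card_eq_sum_ones]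
  exact Finset.sum_congr rfl fun i hi => by simp [multilinearExp_apply, hi]

/-- The iterated finite difference of a monomial of degree at most `#γ`. -/
theorem sum_powerset_eval_monomial {σ F : Type*} [Fintype σ] [DecidableEq σ] [CommRing F]
    (γ : Finset σ) (c : σ → F) (s : σ →₀ ℕ) (hs : s.degree ≤ γ.card) :
    ∑ h ∈ γ.powerset, (-1 : F) ^ (γ \ h).card * ∏ i, (c + indicatorVec F h) i ^ s i =
      if multilinearExp γ = s then 1 else 0 := by
  -- The alternating sum factors over coordinates. A coordinate of `γ` contributes `(c i + 1) ^ s i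
  -- - c i ^ s i`, which vanishes for `s i = 0` and equals `1` for `s i = 1`.
  have key : ∑ h ∈ γ.powerset, (-1 : F) ^ (γ \ h).card * ∏ i, (c + indicatorVec F h) i ^ s i =
      (∏ i ∈ γᶜ, c i ^ s i) * ∏ i ∈ γ, ((c i + 1) ^ s i + -(c i ^ s i)) := by
    rw [Finset.prod_add, Finset.mul_sum]
    refine Finset.sum_congr rfl fun h hh => ?_
    rw [Finset.mem_powerset] at hh
    rw [Finset.prod_neg, ← Finset.prod_compl_mul_prod γ, ← Finset.prod_sdiff hh]
    have e1 : ∏ i ∈ γᶜ, (c + indicatorVec F h) i ^ s i = ∏ i ∈ γᶜ, c i ^ s i :=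
      Finset.prod_congr rfl fun i hi => by
        have : i ∉ h := fun h' => (Finset.mem_compl.1 hi) (hh h')
        simp [indicatorVec, this]
    have e2 : ∏ i ∈ γ \ h, (c + indicatorVec F h) i ^ s i = ∏ i ∈ γ \ h, c i ^ s i :=
      Finset.prod_congr rfl fun i hi => by
        have : i ∉ h := (Finset.mem_sdiff.1 hi).2
        simp [indicatorVec, this]
    have e3 : ∏ i ∈ h, (c + indicatorVec F h) i ^ s i = ∏ i ∈ h, (c i + 1) ^ s i :=
      Finset.prod_congr rfl fun i hi => by simp [indicatorVec, hi]
    rw [e1, e2, e3]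
    ring
  rw [key]
  split_ifs with hγ
  · subst hγ
    rw [Finset.prod_eq_one, Finset.prod_eq_one]
    · simp
    · intro i hi; simp [multilinearExp_apply, hi]
    · intro i hi; simp [multilinearExp_apply, Finset.mem_compl.1 hi]
  -- If `s` were positive on all of `γ`, the bound on its degree would leave room only for exponent
  -- `1` on `γ` and `0` elsewhere.
  · have : ∃ i ∈ γ, s i = 0 := by
      by_contra! hne
      apply hγ
      have hle : ∀ i ∈ γ, 1 ≤ s i := fun i hi => Nat.one_le_iff_ne_zero.2 (hne i hi)
      have hdeg : s.degree = ∑ i ∈ γᶜ, s i + ∑ i ∈ γ, s i := by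
        rw [Finset.sum_compl_add_sum, Finsupp.degree_eq_sum]
      have h1 : γ.card ≤ ∑ i ∈ γ, s i := by
        rw [Finset.card_eq_sum_ones]; exact Finset.sum_le_sum hle
      have h2 : ∑ i ∈ γᶜ, s i = 0 := by omega
      have h3 : ∑ i ∈ γ, 1 = ∑ i ∈ γ, s i := by
        rw [← Finset.card_eq_sum_ones]; omega
      rw [Finset.sum_eq_zero_iff] at h2
      rw [Finset.sum_eq_sum_iff_of_le hle] at h3
      ext i
      rw [multilinearExp_apply]
      split_ifs with hi
      · exact h3 i hi
      · exact (h2 i (Finset.mem_compl.2 hi)).symm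
    obtain ⟨i, hi, h0⟩ := this
    rw [Finset.prod_eq_zero hi (by simp [h0]), mul_zero]

/-- The coefficient of a multilinear monomial of top degree is an iterated finite difference. -/
theorem sum_powerset_eval {σ F : Type*} [Fintype σ] [DecidableEq σ] [CommRing F]
    (γ : Finset σ) (c : σ → F) (P : MvPolynomial σ F) (hP : P.totalDegree ≤ γ.card) :
    ∑ h ∈ γ.powerset, (-1 : F) ^ (γ \ h).card * eval (c + indicatorVec F h) P =
      coeff (multilinearExp γ) P := by
  have h1 : ∀ h ∈ γ.powerset, (-1 : F) ^ (γ \ h).card * eval (c + indicatorVec F h) P =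
      ∑ s ∈ P.support, coeff s P *
        ((-1 : F) ^ (γ \ h).card * ∏ i, (c + indicatorVec F h) i ^ s i) := by
    intro h _
    rw [eval_eq', Finset.mul_sum]
    exact Finset.sum_congr rfl fun s _ => by ring
  rw [Finset.sum_congr rfl h1, Finset.sum_comm]
  have h2 : ∀ s ∈ P.support, ∑ h ∈ γ.powerset, coeff s P *
        ((-1 : F) ^ (γ \ h).card * ∏ i, (c + indicatorVec F h) i ^ s i) =
      if multilinearExp γ = s then coeff s P else 0 := by
    intro s hs
    rw [← Finset.mul_sum, sum_powerset_eval_monomial γ c s ((le_totalDegree hs).trans hP)]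
    split_ifs <;> simp
  rw [Finset.sum_congr rfl h2, Finset.sum_ite_eq]
  split_ifs with h
  · rfl
  · exact (notMem_support_iff.1 h).symm

/-- A family of polynomials with distinct leading multilinear monomials of degree `D` has an
evaluation rank that drops by at most the number of deleted points. -/
theorem card_le_finrank_span_add {σ F : Type*} [Fintype σ] [DecidableEq σ] [Field F]
    (r : Finset σ → ℕ) (hr : Function.Injective r) (D : ℕ) (L : Finset (Finset σ)) (hL : ∀ γ ∈ L, γ.card = D)
    (V : Set (MvPolynomial σ F)) (Q : Finset σ → MvPolynomial σ F) (hQV : ∀ γ ∈ L, Q γ ∈ V)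
    (hdeg : ∀ γ ∈ L, (Q γ).totalDegree ≤ D)
    (hlead : ∀ γ ∈ L, coeff (multilinearExp γ) (Q γ) ≠ 0)
    (htri : ∀ γ ∈ L, ∀ γ' ∈ L, r γ < r γ' → coeff (multilinearExp γ') (Q γ) = 0)
    (c : σ → F) (S B : Finset (σ → F))
    (hcover : ∀ h : Finset σ, h.card ≤ D → c + indicatorVec F h ∈ S ∨ c + indicatorVec F h ∈ B) :
    L.card ≤ Module.finrank F (Submodule.span F (evalVec S '' V)) + B.card := by
  classical
  let ev : ∀ T : Finset (σ → F), (L → F) →ₗ[F] (T → F) := fun T =>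
    Fintype.linearCombination F (fun γ : L => evalVec T (Q γ))
  have hev : ∀ (T : Finset (σ → F)) (a : L → F) (x : T),
      ev T a x = eval x.1 (∑ γ : L, a γ • Q γ) := by
    intro T a x
    simp [ev, Fintype.linearCombination_apply, evalVec, Finset.sum_apply, map_sum, smul_eval]
  -- Vanishing on `S` and `B` kills every finite difference, hence the coefficients at all `γ ∈ L`.
  -- At the `r`-largest `γ` with `a γ ≠ 0`, only `Q γ` contributes.
  have hinj : ∀ a : L → F, ev S a = 0 → ev B a = 0 → a = 0 := by
    intro a hS hB
    set P := ∑ γ : L, a γ • Q γ with hP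
    have hPdeg : P.totalDegree ≤ D := by
      refine totalDegree_finsetSum_le fun γ _ => ?_
      exact (totalDegree_smul_le _ _).trans (hdeg γ γ.2)
    have hzero : ∀ γ ∈ L, coeff (multilinearExp γ) P = 0 := by
      intro γ hγ
      rw [← sum_powerset_eval γ c P (by rw [hL γ hγ]; exact hPdeg)]
      refine Finset.sum_eq_zero fun h hh => ?_
      have hc : h.card ≤ D := by
        rw [← hL γ hγ]; exact Finset.card_le_card (Finset.mem_powerset.1 hh)
      have : eval (c + indicatorVec F h) P = 0 := by
        rcases hcover h hc with hx | hx
        · rw [← hev S a ⟨_, hx⟩, hS]; rfl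
        · rw [← hev B a ⟨_, hx⟩, hB]; rfl
      rw [this, mul_zero]
    by_contra hne
    have hnon : (Finset.univ.filter fun γ : L => a γ ≠ 0).Nonempty := by
      obtain ⟨γ, hγ⟩ := Function.ne_iff.1 hne
      exact ⟨γ, by simpa using hγ⟩
    obtain ⟨γ, hγ, hmax⟩ := Finset.exists_max_image _ (fun γ : L => r γ) hnon
    have hγ' : a γ ≠ 0 := (Finset.mem_filter.1 hγ).2
    have h0 := hzero γ γ.2
    rw [hP, coeff_sum, Finset.sum_eq_single γ] at h0
    · rw [coeff_smul, smul_eq_mul] at h0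
      exact (mul_ne_zero hγ' (hlead γ γ.2)) h0
    · intro δ _ hδ
      rw [coeff_smul, smul_eq_mul]
      by_cases haδ : a δ = 0
      · rw [haδ, zero_mul]
      · have hle : r δ ≤ r γ := hmax δ (by simpa using haδ)
        rw [htri δ δ.2 γ γ.2 (lt_of_le_of_ne hle fun h => hδ (Subtype.ext (hr h))), mul_zero]
    · simp
  -- By `hinj`, evaluation on `B` is injective on the kernel of evaluation on `S`.
  have hker : Module.finrank F (LinearMap.ker (ev S)) ≤ B.card := by
    have := LinearMap.finrank_le_finrank_of_injective
      (f := (ev B).comp (LinearMap.ker (ev S)).subtype) ?_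
    · simpa using this
    · rw [← LinearMap.ker_eq_bot, LinearMap.ker_eq_bot']
      intro a ha
      exact Subtype.ext (hinj a a.2 ha)
  have hrange : Module.finrank F (LinearMap.range (ev S)) ≤
      Module.finrank F (Submodule.span F (evalVec S '' V)) := by
    apply Submodule.finrank_mono
    rw [Fintype.range_linearCombination]
    apply Submodule.span_mono
    rintro _ ⟨γ, rfl⟩
    exact ⟨_, hQV γ γ.2, rfl⟩
  have := LinearMap.finrank_range_add_finrank_ker (ev S)
  rw [Module.finrank_fintype_fun_eq_card, Fintype.card_coe] at this
  omega

/-! ### The evaluation matrix, and derivatives of multilinear monomials. -/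

theorem rank_evalMatrix {σ F : Type*} [Finite σ] [Field F] (k ℓ : ℕ) (S : Finset (σ → F))
    (P : MvPolynomial σ F) : (evalMatrix k ℓ S P).rank = Gam k ℓ S P := by
  have hfin : ∀ j : ℕ, Finite {α : σ →₀ ℕ // α.degree = j} := fun j =>
    ((Finsupp.finite_of_degree_le j).subset fun α (hα : α.degree = j) => hα.le).to_subtype
  have := hfin k
  have := hfin ℓ
  rw [Matrix.rank_eq_finrank_span_row, Gam]
  have hset : Set.range (evalMatrix k ℓ S P).row = evalVec S '' shiftedPartials k ℓ P := by
    ext v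
    constructor
    · rintro ⟨⟨⟨α, hα⟩, ⟨β, hβ⟩⟩, rfl⟩
      exact ⟨_, ⟨α, β, hα, hβ, rfl⟩, rfl⟩
    · rintro ⟨_, ⟨α, β, hα, hβ, rfl⟩, rfl⟩
      exact ⟨⟨⟨α, hα⟩, ⟨β, hβ⟩⟩, rfl⟩
  rw [hset]

theorem pderiv_prod_X {σ F : Type*} [DecidableEq σ] [CommRing F] (i : σ) (s : Finset σ) :
    pderiv i (∏ x ∈ s, X x : MvPolynomial σ F) =
      if i ∈ s then ∏ x ∈ s.erase i, X x else 0 := by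
  have h0 : ∀ s : Finset σ, i ∉ s → pderiv i (∏ x ∈ s, X x : MvPolynomial σ F) = 0 := by
    intro s
    induction s using Finset.induction_on with
    | empty => simp
    | insert a s ha ih =>
      intro h
      rw [Finset.mem_insert, not_or] at h
      rw [Finset.prod_insert ha, pderiv_mul, ih h.2, pderiv_X_of_ne (Ne.symm h.1)]
      simp
  split_ifs with h
  · rw [← Finset.mul_prod_erase s _ h, pderiv_mul, h0 _ (Finset.notMem_erase i s)]
    simp
  · exact h0 s h

theorem partialDeriv_prod_X {σ F : Type*} [DecidableEq σ] [CommRing F] (a s : Finset σ) :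
    partialDeriv (multilinearExp a) (∏ x ∈ s, X x : MvPolynomial σ F) =
      if a ⊆ s then ∏ x ∈ s \ a, X x else 0 := by
  have hval : ∀ a : Finset σ, Finsupp.toMultiset (multilinearExp a) = a.val := by
    intro a
    ext i
    rw [Finsupp.count_toMultiset, multilinearExp_apply, Multiset.count_eq_of_nodup a.nodup]
    rfl
  rw [partialDeriv, hval]
  induction a using Finset.induction_on with
  | empty => simp
  | insert b a hb ih =>
    rw [Finset.insert_val_of_notMem hb, Multiset.foldr_cons, ih]
    by_cases ha : a ⊆ s
    · rw [if_pos ha, pderiv_prod_X]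
      by_cases hbs : b ∈ s
      · rw [if_pos (by simp [hb, hbs]), if_pos (Finset.insert_subset hbs ha)]
        congr 1
        ext x; simp; tauto
      · rw [if_neg (by simp [hbs]), if_neg fun h => hbs (h (Finset.mem_insert_self b a))]
    · rw [if_neg ha, if_neg fun h => ha ((Finset.subset_insert b a).trans h), map_zero]

theorem partialDeriv_sum {σ F ι : Type*} [CommRing F] (α : σ →₀ ℕ) (s : Finset ι)
    (P : ι → MvPolynomial σ F) :
    partialDeriv α (∑ j ∈ s, P j) = ∑ j ∈ s, partialDeriv α (P j) := by
  unfold partialDeriv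
  induction Finsupp.toMultiset α using Multiset.induction_on with
  | empty => simp
  | cons i t ih => simp only [Multiset.foldr_cons, ih, map_sum]

theorem prod_X_eq_monomial {σ F : Type*} [CommRing F] (s : Finset σ) :
    (∏ x ∈ s, X x : MvPolynomial σ F) = monomial (multilinearExp s) 1 := by
  classical
  rw [monomial_eq, map_one, one_mul, Finsupp.prod_of_support_subset (s := s)]
  · exact Finset.prod_congr rfl fun i hi => by simp [multilinearExp_apply, hi]
  · intro i hi
    by_contra h
    simp [multilinearExp_apply, h] at hi
  · simp

theorem multilinearExp_add_eq {σ : Type*} [DecidableEq σ] (b s γ : Finset σ) :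
    multilinearExp b + multilinearExp s = multilinearExp γ ↔ Disjoint b s ∧ b ∪ s = γ := by
  constructor
  · intro h
    have h' : ∀ i, (if i ∈ b then 1 else 0) + (if i ∈ s then 1 else 0) =
        if i ∈ γ then 1 else 0 := fun i => by
      simpa [multilinearExp_apply] using DFunLike.congr_fun h i
    constructor
    · rw [Finset.disjoint_left]
      intro i hb hs
      have := h' i
      simp only [hb, hs, if_true] at this
      split_ifs at this
      omega
    · ext i
      have := h' i
      rw [Finset.mem_union]
      split_ifs at this <;> simp_all
  · rintro ⟨hd, rfl⟩
    ext i
    rw [Finset.disjoint_left] at hd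
    have := @hd i
    simp only [Finsupp.add_apply, multilinearExp_apply, Finset.mem_union]
    split_ifs <;> simp_all

/-! ### Unions of two graphs. -/

/-- The graph of `g` over the finite set `I`. -/
def graphOver {A K : Type*} (I : Finset A) (g : A → K) : Finset (A × K) :=
  I.map ⟨fun i => (i, g i), fun _ _ h => (Prod.ext_iff.1 h).1⟩

theorem mem_graphOver {A K : Type*} {I : Finset A} {g : A → K} {x : A × K} :
    x ∈ graphOver I g ↔ x.1 ∈ I ∧ g x.1 = x.2 := by
  rcases x with ⟨i, y⟩
  rw [graphOver, Finset.mem_map]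
  constructor
  · rintro ⟨a, ha, h⟩
    obtain ⟨rfl, rfl⟩ : a = i ∧ g a = y := Prod.ext_iff.1 h
    exact ⟨ha, rfl⟩
  · rintro ⟨hi, h⟩
    exact ⟨i, hi, Prod.ext rfl h⟩

theorem card_graphOver {A K : Type*} (I : Finset A) (g : A → K) :
    (graphOver I g).card = I.card := by
  simp [graphOver]

theorem graphOver_eq_iff {A K : Type*} {I : Finset A} {g g' : A → K} :
    graphOver I g = graphOver I g' ↔ ∀ i ∈ I, g i = g' i := by
  constructor
  · intro h i hi
    have : (i, g i) ∈ graphOver I g' := h ▸ mem_graphOver.2 ⟨hi, rfl⟩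
    exact (mem_graphOver.1 this).2.symm
  · intro h
    ext ⟨i, y⟩
    simp only [mem_graphOver]
    exact ⟨fun ⟨hi, hy⟩ => ⟨hi, (h i hi) ▸ hy⟩, fun ⟨hi, hy⟩ => ⟨hi, (h i hi).symm ▸ hy⟩⟩

theorem card_graphOver_union {A K : Type*} [DecidableEq A] [DecidableEq K] (I : Finset A)
    (g g' : A → K) :
    (graphOver I g ∪ graphOver I g').card + (I.filter fun i => g i = g' i).card = 2 * I.card := by
  have : graphOver I g ∩ graphOver I g' = graphOver (I.filter fun i => g i = g' i) g := by
    ext ⟨i, y⟩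
    simp only [Finset.mem_inter, mem_graphOver, Finset.mem_filter]
    constructor
    · rintro ⟨⟨h1, rfl⟩, _, h3⟩
      exact ⟨⟨h1, h3.symm⟩, rfl⟩
    · rintro ⟨⟨h1, h2⟩, rfl⟩
      exact ⟨⟨h1, rfl⟩, h1, h2.symm⟩
  rw [← card_graphOver (I.filter fun i => g i = g' i) g, ← this, Finset.card_union_add_card_inter,
    card_graphOver, card_graphOver, two_mul]

/-- In a family of functions that is pairwise as spread out as a random one, the sizes of the
unions of two graphs are distributed almost as in the independent case. -/
theorem sum_pow_card_graphOver_union_le {ι A K : Type*} [DecidableEq ι] [DecidableEq A]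
    [DecidableEq K] (P : Finset ι) (f : ι → A → K) (I : Finset A) {w m : ℝ} (hw : 0 < w)
    (hm : 0 < m)
    (hP : ∀ q ∈ P, ∀ J ⊆ I,
      ((P.filter fun q' => q' ≠ q ∧ ∀ i ∈ J, f q i = f q' i).card : ℝ) * m ^ J.card ≤ P.card) :
    ∑ q ∈ P, ∑ q' ∈ P, w ^ (graphOver I (f q) ∪ graphOver I (f q')).card ≤
      P.card * w ^ I.card + (P.card * w ^ I.card) ^ 2 * (1 + w⁻¹ / m) ^ I.card := by
  set t := I.card with ht
  have hterm : ∀ q q', w ^ (graphOver I (f q) ∪ graphOver I (f q')).card =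
      w ^ (2 * t) * w⁻¹ ^ (I.filter fun i => f q i = f q' i).card := by
    intro q q'
    rw [ht, ← card_graphOver_union I (f q) (f q'), pow_add, mul_assoc, ← mul_pow,
      mul_inv_cancel₀ hw.ne', one_pow, mul_one]
  have hone : ∀ q ∈ P, ∑ q' ∈ P, w ^ (graphOver I (f q) ∪ graphOver I (f q')).card ≤
      w ^ t + P.card * w ^ (2 * t) * (1 + w⁻¹ / m) ^ t := by
    intro q hq
    rw [← Finset.add_sum_erase P _ hq, Finset.union_self, card_graphOver]
    gcongr
    -- Enlarging `w⁻¹` to `1 + w⁻¹` turns the power into a sum over subsets `J` of the agreement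
    -- set. After exchanging sums, only the number of `q'` agreeing with `q` on a prescribed `J`
    -- matters, which is what `hP` bounds.
    have hexp : ∀ q', w⁻¹ ^ (I.filter fun i => f q i = f q' i).card ≤
        ∑ J ∈ I.powerset, if ∀ i ∈ J, f q i = f q' i then w⁻¹ ^ J.card else 0 := by
      intro q'
      have h1 : w⁻¹ ^ (I.filter fun i => f q i = f q' i).card ≤
          (1 + w⁻¹) ^ (I.filter fun i => f q i = f q' i).card :=
        pow_le_pow_left₀ (by positivity) (by linarith) _
      refine h1.trans (le_of_eq ?_)
      rw [← Finset.sum_filter, ← Finset.prod_const, Finset.prod_one_add]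
      simp only [Finset.prod_const]
      refine Finset.sum_congr ?_ fun _ _ => rfl
      ext J
      simp only [Finset.mem_powerset, Finset.mem_filter, Finset.subset_iff]
      exact ⟨fun h => ⟨fun i hi => (h hi).1, fun i hi => (h hi).2⟩,
        fun h i hi => ⟨h.1 hi, h.2 i hi⟩⟩
    calc ∑ q' ∈ P.erase q, w ^ (graphOver I (f q) ∪ graphOver I (f q')).card
        ≤ ∑ q' ∈ P.erase q, w ^ (2 * t) *
          ∑ J ∈ I.powerset, if ∀ i ∈ J, f q i = f q' i then w⁻¹ ^ J.card else 0 := by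
          refine Finset.sum_le_sum fun q' _ => ?_
          rw [hterm]
          exact mul_le_mul_of_nonneg_left (hexp q') (by positivity)
      _ = w ^ (2 * t) * ∑ J ∈ I.powerset, w⁻¹ ^ J.card *
          ((P.filter fun q' => q' ≠ q ∧ ∀ i ∈ J, f q i = f q' i).card : ℝ) := by
          rw [← Finset.mul_sum, Finset.sum_comm]
          congr 1
          refine Finset.sum_congr rfl fun J _ => ?_
          rw [← Finset.sum_filter, Finset.sum_const, nsmul_eq_mul, mul_comm]
          congr 3
          ext q'
          simp only [Finset.mem_filter, Finset.mem_erase]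
          tauto
      _ ≤ w ^ (2 * t) * ∑ J ∈ I.powerset, P.card * (w⁻¹ / m) ^ J.card := by
          refine mul_le_mul_of_nonneg_left (Finset.sum_le_sum fun J hJ => ?_) (by positivity)
          have := hP q hq J (Finset.mem_powerset.1 hJ)
          rw [div_pow, mul_div_assoc', le_div_iff₀ (by positivity)]
          calc _ = w⁻¹ ^ J.card * (((P.filter fun q' =>
                    q' ≠ q ∧ ∀ i ∈ J, f q i = f q' i).card : ℝ) * m ^ J.card) := by ring
            _ ≤ w⁻¹ ^ J.card * P.card := by gcongr
            _ = _ := by ring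
      _ = P.card * w ^ (2 * t) * (1 + w⁻¹ / m) ^ t := by
          rw [← Finset.mul_sum, ht, ← Finset.prod_const (b := 1 + w⁻¹ / m), Finset.prod_one_add]
          simp only [Finset.prod_const]
          ring
  calc _ ≤ ∑ q ∈ P, (w ^ t + P.card * w ^ (2 * t) * (1 + w⁻¹ / m) ^ t) := Finset.sum_le_sum hone
    _ = _ := by
      rw [Finset.sum_const, nsmul_eq_mul]
      ring

/-! ### Binomial ratios and Cauchy–Schwarz for incidences. -/

/-- A random `ℓ`-set avoids `s` given points at most as often as with independent choices: each
successive ratio `(n - s - ℓ) / (n - s)` is at most `(n - ℓ) / n`. -/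
theorem choose_sub_le {n ℓ : ℕ} (hℓ : ℓ ≤ n) (hn : 0 < n) (s : ℕ) (hs : s ≤ n) :
    ((n - s).choose ℓ : ℝ) ≤ n.choose ℓ * (((n : ℝ) - ℓ) / n) ^ s := by
  induction s with
  | zero => simp
  | succ s ih =>
    have ih := ih (by omega)
    have hn' : (0 : ℝ) < n := by exact_mod_cast hn
    have hnl : (ℓ : ℝ) ≤ n := by exact_mod_cast hℓ
    have hs' : (s : ℝ) + 1 ≤ n := by exact_mod_cast hs
    have hu : 0 ≤ ((n : ℝ) - ℓ) / n := div_nonneg (by linarith) hn'.le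
    by_cases hle : ℓ ≤ n - s
    · have h := Nat.choose_mul_succ_eq (n - (s + 1)) ℓ
      rw [show n - (s + 1) + 1 = n - s by omega] at h
      have h' : ((n - (s + 1)).choose ℓ : ℝ) * ((n : ℝ) - s) =
          (n - s).choose ℓ * ((n : ℝ) - s - ℓ) := by
        have := congrArg (Nat.cast : ℕ → ℝ) h
        push_cast [Nat.cast_sub hle, Nat.cast_sub (show s ≤ n by omega),
          Nat.cast_sub hs] at this
        linarith
      have hpos : (0 : ℝ) < (n : ℝ) - s := by linarith
      have hfac : ((n : ℝ) - s - ℓ) ≤ ((n : ℝ) - ℓ) / n * ((n : ℝ) - s) := by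
        rw [div_mul_eq_mul_div, le_div_iff₀ hn']
        have : (0 : ℝ) ≤ (ℓ : ℝ) * s := by positivity
        nlinarith
      rw [pow_succ, ← mul_assoc]
      refine le_of_mul_le_mul_right ?_ hpos
      rw [h', mul_assoc (_ * _) (((n : ℝ) - ℓ) / n)]
      have h0 : 0 ≤ (n : ℝ) - s - ℓ := by
        have : (ℓ : ℝ) ≤ (n - s : ℕ) := by exact_mod_cast hle
        rw [Nat.cast_sub (by omega)] at this
        linarith
      exact mul_le_mul ih hfac h0 (by positivity)
    · rw [Nat.choose_eq_zero_of_lt (by omega)]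
      simp only [Nat.cast_zero]
      positivity

theorem le_choose_sub {n ℓ t : ℕ} (ht : t + ℓ ≤ n) (hn : 0 < n) :
    (n.choose ℓ : ℝ) * (((n : ℝ) - ℓ - t) / n) ^ t ≤ (n - t).choose ℓ := by
  have hn' : (0 : ℝ) < n := by exact_mod_cast hn
  have hnl : (t : ℝ) + ℓ ≤ n := by exact_mod_cast ht
  set v := ((n : ℝ) - ℓ - t) / n with hv
  have hv0 : 0 ≤ v := div_nonneg (by linarith) hn'.le
  suffices ∀ s ≤ t, (n.choose ℓ : ℝ) * v ^ s ≤ (n - s).choose ℓ from this t le_rfl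
  intro s hs
  induction s with
  | zero => simp
  | succ s ih =>
    have ih := ih (by omega)
    have h := Nat.choose_mul_succ_eq (n - (s + 1)) ℓ
    rw [show n - (s + 1) + 1 = n - s by omega] at h
    have h' : ((n - (s + 1)).choose ℓ : ℝ) * ((n : ℝ) - s) =
        (n - s).choose ℓ * ((n : ℝ) - s - ℓ) := by
      have := congrArg (Nat.cast : ℕ → ℝ) h
      push_cast [Nat.cast_sub (show ℓ ≤ n - s by omega), Nat.cast_sub (show s ≤ n by omega),
        Nat.cast_sub (show s + 1 ≤ n by omega)] at this
      linarith
    have hs' : (s : ℝ) + 1 ≤ t := by exact_mod_cast hs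
    have hl0 : (0 : ℝ) ≤ ℓ := by positivity
    have hs0 : (0 : ℝ) ≤ s := by positivity
    have hpos : (0 : ℝ) < (n : ℝ) - s := by linarith
    have hfac : v * ((n : ℝ) - s) ≤ (n : ℝ) - s - ℓ := by
      rw [hv, div_mul_eq_mul_div, div_le_iff₀ hn']
      nlinarith [mul_nonneg hs0 hl0, mul_nonneg hs0 (hs0.trans (by linarith : (s : ℝ) ≤ t))]
    refine le_of_mul_le_mul_right ?_ hpos
    rw [h', pow_succ, ← mul_assoc, mul_assoc (_ * _) v]
    exact mul_le_mul ih hfac (mul_nonneg hv0 hpos.le) (by positivity)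

theorem choose_add_mul_pow_le (n ℓ t : ℕ) :
    n.choose (ℓ + t) * ℓ ^ t ≤ n.choose ℓ * (n - ℓ) ^ t := by
  induction t with
  | zero => simp
  | succ t ih =>
    have h := Nat.choose_succ_right_eq n (ℓ + t)
    calc n.choose (ℓ + (t + 1)) * ℓ ^ (t + 1)
        ≤ n.choose (ℓ + (t + 1)) * (ℓ ^ t * (ℓ + t + 1)) := by
          rw [pow_succ]; gcongr; omega
      _ = (n.choose (ℓ + t) * ℓ ^ t) * (n - (ℓ + t)) := by
          rw [← add_assoc, mul_comm (ℓ ^ t), ← mul_assoc, h]; ring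
      _ ≤ (n.choose ℓ * (n - ℓ) ^ t) * (n - ℓ) := Nat.mul_le_mul ih (by omega)
      _ = _ := by ring

theorem card_filter_disjoint {σ : Type*} [Fintype σ] [DecidableEq σ] (ℓ : ℕ) (M : Finset σ) :
    ((Finset.univ.powersetCard ℓ).filter fun b => Disjoint b M).card =
      (Fintype.card σ - M.card).choose ℓ := by
  rw [← Finset.card_compl, ← Finset.card_powersetCard]
  congr 1
  ext b
  simp only [Finset.mem_filter, Finset.mem_powersetCard, Finset.subset_univ, true_and,
    Finset.subset_compl_iff_disjoint_right]
  tauto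

theorem card_filter_superset {σ : Type*} [Fintype σ] [DecidableEq σ] {D : ℕ}
    (hD : D ≤ Fintype.card σ) (M : Finset σ) :
    ((Finset.univ.powersetCard D).filter fun γ => M ⊆ γ).card =
      (Fintype.card σ - M.card).choose (Fintype.card σ - D) := by
  rw [← card_filter_disjoint]
  refine Finset.card_bij' (fun γ _ => γᶜ) (fun γ _ => γᶜ) ?_ ?_ (by simp) (by simp)
  · intro γ
    simp only [Finset.mem_filter, Finset.mem_powersetCard, Finset.subset_univ, true_and,
      Finset.card_compl]
    rintro ⟨rfl, h⟩
    exact ⟨rfl, Finset.disjoint_left.2 fun x hx hM => Finset.mem_compl.1 hx (h hM)⟩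
  · intro γ
    simp only [Finset.mem_filter, Finset.mem_powersetCard, Finset.subset_univ, true_and,
      Finset.card_compl]
    rintro ⟨h1, h⟩
    exact ⟨by omega, fun x hx => Finset.mem_compl.2 fun hγ => Finset.disjoint_left.1 h hγ hx⟩

/-- Second moment bound, used in both counts. The squares are summed over all of `𝓑` rather than
`𝓛`, so that the pair counts on the right become explicit binomial coefficients. -/
theorem sq_sum_card_filter_le {B ι : Type*} [DecidableEq ι] (𝓑 𝓛 : Finset B) (h𝓛 : 𝓛 ⊆ 𝓑)
    (P : Finset ι) (rel : B → ι → Prop) [∀ b q, Decidable (rel b q)] :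
    ((∑ b ∈ 𝓛, ((P.filter fun q => rel b q).card : ℝ))) ^ 2 ≤
      𝓛.card * ∑ q ∈ P, ∑ q' ∈ P, ((𝓑.filter fun b => rel b q ∧ rel b q').card : ℝ) := by
  refine sq_sum_le_card_mul_sum_sq.trans ?_
  gcongr
  calc ∑ b ∈ 𝓛, ((P.filter fun q => rel b q).card : ℝ) ^ 2
      ≤ ∑ b ∈ 𝓑, ((P.filter fun q => rel b q).card : ℝ) ^ 2 :=
        Finset.sum_le_sum_of_subset_of_nonneg h𝓛 fun _ _ _ => by positivity
    _ = ∑ b ∈ 𝓑, ∑ q ∈ P, ∑ q' ∈ P, if rel b q ∧ rel b q' then (1 : ℝ) else 0 := by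
        refine Finset.sum_congr rfl fun b _ => ?_
        rw [sq, Finset.card_filter, Nat.cast_sum, Finset.sum_mul_sum]
        refine Finset.sum_congr rfl fun q _ => Finset.sum_congr rfl fun q' _ => ?_
        by_cases h1 : rel b q <;> by_cases h2 : rel b q' <;> simp [h1, h2]
    _ = _ := by
        rw [Finset.sum_comm]
        refine Finset.sum_congr rfl fun q _ => ?_
        rw [Finset.sum_comm]
        refine Finset.sum_congr rfl fun q' _ => ?_
        rw [Finset.card_filter, Nat.cast_sum]
        simp

/-! ### Interpolating families and the count of leading monomials. -/

/-- The functions `f q`, `q : ι`, behave like the polynomials of degree less than `e`: there are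
`m ^ (e - #J)` of them with given values on `J` if `#J ≤ e`, and they are determined by their
values on `J` if `e ≤ #J`. -/
structure IsInterpolating {ι A K : Type*} [Fintype ι] [Fintype K] [DecidableEq K]
    (f : ι → A → K) (e : ℕ) : Prop where
  card_mul (q : ι) (J : Finset A) : J.card ≤ e →
    (Finset.univ.filter fun q' => ∀ i ∈ J, f q i = f q' i).card * Fintype.card K ^ J.card =
      Fintype.card K ^ e
  eq_of_eqOn (q q' : ι) (J : Finset A) : e ≤ J.card → (∀ i ∈ J, f q i = f q' i) → q = q'

/-- While `I ∪ J` has at most `e` elements the count of agreeing functions is exact. Beyond that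
only `q` itself agrees, which is why `q' = q` has to be excluded. -/
theorem IsInterpolating.spread {ι A K : Type*} [Fintype ι] [Fintype K] [Nonempty K]
    [DecidableEq K] [DecidableEq ι] [DecidableEq A] [Fintype A] {f : ι → A → K} {e : ℕ}
    (hf : IsInterpolating f e)
    (I : Finset A) (hI : I.card ≤ e) (q₀ q : ι)
    (hq : q ∈ Finset.univ.filter fun q' => ∀ i ∈ I, f q₀ i = f q' i) (J : Finset A) (hJ : J ⊆ Iᶜ) :
    (((Finset.univ.filter fun q' => ∀ i ∈ I, f q₀ i = f q' i).filter
      fun q' => q' ≠ q ∧ ∀ i ∈ J, f q i = f q' i).card : ℝ) * (Fintype.card K : ℝ) ^ J.card ≤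
      (Finset.univ.filter fun q' => ∀ i ∈ I, f q₀ i = f q' i).card := by
  set P := Finset.univ.filter fun q' => ∀ i ∈ I, f q₀ i = f q' i with hP
  have hq' : ∀ i ∈ I, f q₀ i = f q i := (Finset.mem_filter.1 hq).2
  have hm : 0 < Fintype.card K := Fintype.card_pos
  have hcard : (I ∪ J).card = I.card + J.card :=
    Finset.card_union_of_disjoint
      (Finset.disjoint_left.2 fun i hi hj => Finset.mem_compl.1 (hJ hj) hi)
  have hagree : ∀ q' ∈ P.filter fun q' => q' ≠ q ∧ ∀ i ∈ J, f q i = f q' i,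
      ∀ i ∈ I ∪ J, f q i = f q' i := by
    intro q' h' i hi
    simp only [hP, Finset.mem_filter, Finset.mem_univ, true_and] at h'
    rcases Finset.mem_union.1 hi with hi | hi
    · rw [← hq' i hi, h'.1 i hi]
    · exact h'.2.2 i hi
  have key : (P.filter fun q' => q' ≠ q ∧ ∀ i ∈ J, f q i = f q' i).card *
      Fintype.card K ^ J.card ≤ P.card := by
    rcases le_total (I ∪ J).card e with h | h
    · refine Nat.le_of_mul_le_mul_right (c := Fintype.card K ^ I.card) ?_ (by positivity)
      have hPI : P.card * Fintype.card K ^ I.card = Fintype.card K ^ e := by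
        convert hf.card_mul q₀ I hI
      rw [hPI, ← hf.card_mul q (I ∪ J) h, hcard, pow_add, mul_assoc, mul_comm (_ ^ J.card)]
      refine Nat.mul_le_mul_right _ (Finset.card_le_card fun q' h' => ?_)
      simpa only [Finset.mem_filter_univ] using hagree q' h'
    · rw [Finset.card_eq_zero.2, zero_mul]
      · exact Nat.zero_le _
      · refine Finset.eq_empty_of_forall_notMem fun q' h' => ?_
        exact (Finset.mem_filter.1 h').2.1 (hf.eq_of_eqOn q q' _ h (hagree q' h')).symm
  exact_mod_cast key

theorem IsInterpolating.card_image_graphOver {ι A K : Type*} [Fintype ι] [Nonempty ι] [Fintype K]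
    [Nonempty K] [DecidableEq K] [DecidableEq A] {f : ι → A → K} {e : ℕ}
    (hf : IsInterpolating f e) (I : Finset A) (hI : I.card ≤ e) :
    (Finset.univ.image fun q => graphOver I (f q)).card = Fintype.card K ^ I.card := by
  have hm : 0 < Fintype.card K := Fintype.card_pos
  obtain ⟨q₁⟩ := ‹Nonempty ι›
  have htot := hf.card_mul q₁ ∅ (by simp)
  have hsum := Finset.card_eq_sum_card_image (fun q => graphOver I (f q)) (Finset.univ : Finset ι)
  have hfib : ∀ a ∈ Finset.univ.image fun q => graphOver I (f q),
      (Finset.univ.filter fun q => graphOver I (f q) = a).card * Fintype.card K ^ I.card =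
        Fintype.card K ^ e := by
    intro a ha
    obtain ⟨q, _, rfl⟩ := Finset.mem_image.1 ha
    rw [← hf.card_mul q I hI]
    congr 2
    ext q'
    simp only [Finset.mem_filter, Finset.mem_univ, true_and, graphOver_eq_iff]
    exact ⟨fun h i hi => (h i hi).symm, fun h i hi => (h i hi).symm⟩
  have h2 : (Finset.univ : Finset ι).card * Fintype.card K ^ I.card =
      (Finset.univ.image fun q => graphOver I (f q)).card * Fintype.card K ^ e := by
    rw [hsum, Finset.sum_mul, Finset.sum_congr rfl hfib, Finset.sum_const, smul_eq_mul]
  simp only [Finset.notMem_empty, IsEmpty.forall_iff, implies_true, Finset.filter_true,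
    Finset.card_empty, pow_zero, mul_one] at htot
  rw [htot, mul_comm] at h2
  exact (Nat.eq_of_mul_eq_mul_right (by positivity) h2).symm

/-- Many sets `b` of size `ℓ` avoid the graph of some function in a given class. -/
theorem IsInterpolating.choose_mul_le_card {ι A K : Type*} [Fintype ι] [Fintype K] [Nonempty K]
    [DecidableEq K] [DecidableEq ι] [DecidableEq A] [Fintype A] {f : ι → A → K} {e ℓ n t : ℕ}
    (hf : IsInterpolating f e) (I : Finset A) (hI : I.card ≤ e) (q₀ : ι)
    (hn : n = Fintype.card (A × K)) (hn0 : 0 < n) (ht : t = Iᶜ.card) {u μ : ℝ}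
    (hℓ : ℓ < n) (hu : u = ((n : ℝ) - ℓ) / n)
    (hμ : μ = (Fintype.card K : ℝ) ^ (e - I.card) * u ^ t)
    (hu2 : (1 + u⁻¹ / Fintype.card K) ^ t ≤ 2)
    (hlow : (n.choose ℓ : ℝ) * u ^ t ≤ 2 * (n - t).choose ℓ) :
    (n.choose ℓ : ℝ) * μ ≤ ((Finset.univ.powersetCard ℓ).filter fun b : Finset (A × K) =>
      ∃ q, (∀ i ∈ I, f q₀ i = f q i) ∧ Disjoint b (graphOver Iᶜ (f q))).card * (4 + 8 * μ) := by
  have hm : (0 : ℝ) < Fintype.card K := by exact_mod_cast Fintype.card_pos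
  have hn' : (0 : ℝ) < n := by exact_mod_cast hn0
  have hℓ' : (ℓ : ℝ) < n := by exact_mod_cast hℓ
  have hu0 : 0 < u := by rw [hu]; exact div_pos (by linarith) hn'
  have hμ0 : 0 < μ := by rw [hμ]; positivity
  set P := Finset.univ.filter fun q => ∀ i ∈ I, f q₀ i = f q i with hP
  have hPcard : (P.card : ℝ) = (Fintype.card K : ℝ) ^ (e - I.card) := by
    have h : P.card * Fintype.card K ^ I.card = Fintype.card K ^ e := by
      convert hf.card_mul q₀ I hI
    have h' : P.card = Fintype.card K ^ (e - I.card) := by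
      refine Nat.eq_of_mul_eq_mul_right (m := Fintype.card K ^ I.card) ?_ ?_
      · exact pow_pos Fintype.card_pos _
      · rw [h, ← pow_add, Nat.sub_add_cancel hI]
    exact_mod_cast h'
  set G := fun q => graphOver Iᶜ (f q) with hG
  set 𝓑 : Finset (Finset (A × K)) := Finset.univ.powersetCard ℓ with h𝓑
  have hset : (𝓑.filter fun b => ∃ q, (∀ i ∈ I, f q₀ i = f q i) ∧ Disjoint b (G q)) =
      𝓑.filter fun b => ∃ q ∈ P, Disjoint b (G q) := by
    simp only [hP, Finset.mem_filter, Finset.mem_univ, true_and]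
  rw [hset]
  set 𝓛 := 𝓑.filter fun b => ∃ q ∈ P, Disjoint b (G q) with h𝓛
  have hCS := sq_sum_card_filter_le 𝓑 𝓛 (Finset.filter_subset _ _) P fun b q => Disjoint b (G q)
  have hfirst : ∑ b ∈ 𝓛, ((P.filter fun q => Disjoint b (G q)).card : ℝ) =
      P.card * (n - t).choose ℓ := by
    have e1 : ∑ b ∈ 𝓛, ((P.filter fun q => Disjoint b (G q)).card : ℝ) =
        ∑ b ∈ 𝓑, ((P.filter fun q => Disjoint b (G q)).card : ℝ) := by
      refine Finset.sum_subset (Finset.filter_subset _ _) fun b hb hb' => ?_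
      rw [Nat.cast_eq_zero, Finset.card_eq_zero]
      refine Finset.eq_empty_of_forall_notMem fun q hq => hb' ?_
      obtain ⟨h1, h2⟩ := Finset.mem_filter.1 hq
      exact Finset.mem_filter.2 ⟨hb, q, h1, h2⟩
    rw [e1]
    have e2 : ∀ q ∈ P, ((𝓑.filter fun b => Disjoint b (G q)).card : ℝ) = (n - t).choose ℓ := by
      intro q _
      rw [h𝓑, card_filter_disjoint, hG, card_graphOver, ← hn, ← ht]
    have e3 := Finset.sum_card_bipartiteAbove_eq_sum_card_bipartiteBelow
      (s := 𝓑) (t := P) (fun b q => Disjoint b (G q))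
    simp only [Finset.bipartiteAbove, Finset.bipartiteBelow] at e3
    rw [← Nat.cast_sum, e3, Nat.cast_sum, Finset.sum_congr rfl e2, Finset.sum_const, nsmul_eq_mul]
  have hsecond : ∑ q ∈ P, ∑ q' ∈ P,
      ((𝓑.filter fun b => Disjoint b (G q) ∧ Disjoint b (G q')).card : ℝ) ≤
        n.choose ℓ * (μ + μ ^ 2 * 2) := by
    have e1 : ∀ q q', ((𝓑.filter fun b => Disjoint b (G q) ∧ Disjoint b (G q')).card : ℝ) ≤
        n.choose ℓ * u ^ (G q ∪ G q').card := by
      intro q q'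
      have : ∀ b, (Disjoint b (G q) ∧ Disjoint b (G q')) ↔ Disjoint b (G q ∪ G q') :=
        fun b => Finset.disjoint_union_right.symm
      simp only [this]
      rw [h𝓑, card_filter_disjoint, ← hn, hu]
      exact choose_sub_le hℓ.le hn0 _ (by rw [hn]; exact Finset.card_le_univ _)
    calc _ ≤ ∑ q ∈ P, ∑ q' ∈ P, n.choose ℓ * u ^ (G q ∪ G q').card :=
          Finset.sum_le_sum fun q _ => Finset.sum_le_sum fun q' _ => e1 q q'
      _ = n.choose ℓ * ∑ q ∈ P, ∑ q' ∈ P, u ^ (G q ∪ G q').card := by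
          simp only [← Finset.mul_sum]
      _ ≤ _ := by
          gcongr
          have := sum_pow_card_graphOver_union_le P f Iᶜ hu0 hm fun q hq J hJ => by
            convert hf.spread I hI q₀ q hq J hJ
          rw [← ht, hPcard, ← hμ] at this
          refine this.trans ?_
          gcongr
  rw [hfirst] at hCS
  -- The first moment is at least `n.choose ℓ * μ / 2` by `hlow`. Cancelling one factor `n.choose ℓ
  -- * μ` leaves the constant `4 * (1 + 2 * μ)`.
  have h1 : ((n.choose ℓ : ℝ) * μ / 2) ^ 2 ≤ 𝓛.card * (n.choose ℓ * (μ + μ ^ 2 * 2)) := by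
    refine le_trans ?_ (hCS.trans (by gcongr))
    apply pow_le_pow_left₀ (by positivity)
    rw [hPcard, hμ]
    have := mul_le_mul_of_nonneg_left hlow (pow_pos hm (e - I.card)).le
    nlinarith
  have hc : (0 : ℝ) < n.choose ℓ := by exact_mod_cast Nat.choose_pos hℓ.le
  refine le_of_mul_le_mul_right ?_ (mul_pos hc hμ0)
  nlinarith

/-- There are many leading monomials. -/
theorem IsInterpolating.exists_leading {ι A K : Type*} [Fintype ι] [Nonempty ι] [Fintype K]
    [Nonempty K] [DecidableEq K] [DecidableEq ι] [DecidableEq A] [Fintype A] {f : ι → A → K}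
    {e ℓ n t D : ℕ} (hf : IsInterpolating f e) (I : Finset A) (hI : I.card ≤ e)
    (r : Finset (A × K) → ℕ)
    (hn : n = Fintype.card (A × K)) (hn0 : 0 < n) (ht : t = Iᶜ.card) (hD : D = ℓ + t)
    {u μ w M : ℝ} (hℓ : ℓ < n) (hDn : D ≤ n) (hD0 : 0 < D)
    (hu : u = ((n : ℝ) - ℓ) / n) (hw : w = (D : ℝ) / n)
    (hμ : μ = (Fintype.card K : ℝ) ^ (e - I.card) * u ^ t)
    (hM : M = (Fintype.card K : ℝ) ^ e * w ^ t)
    (hu2 : (1 + u⁻¹ / Fintype.card K) ^ t ≤ 2) (hw2 : (1 + w⁻¹ / Fintype.card K) ^ t ≤ 2)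
    (hlow : (n.choose ℓ : ℝ) * u ^ t ≤ 2 * (n - t).choose ℓ) :
    ∃ L : Finset (Finset (A × K)),
      (∀ γ ∈ L, ∃ (q₀ : ι) (b : Finset (A × K)), b.card = ℓ ∧
        Disjoint b (graphOver Iᶜ (f q₀)) ∧ b ∪ graphOver Iᶜ (f q₀) = γ ∧
        ∀ q, (∀ i ∈ I, f q₀ i = f q i) → Disjoint b (graphOver Iᶜ (f q)) →
          r (b ∪ graphOver Iᶜ (f q)) ≤ r γ) ∧
      ((Fintype.card K : ℝ) ^ I.card * (n.choose ℓ * μ)) ^ 2 ≤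
        L.card * (n.choose D * (M + M ^ 2 * 2)) * (4 + 8 * μ) ^ 2 := by
  have hm : (0 : ℝ) < Fintype.card K := by exact_mod_cast Fintype.card_pos
  have hn' : (0 : ℝ) < n := by exact_mod_cast hn0
  have hℓ' : (ℓ : ℝ) < n := by exact_mod_cast hℓ
  have hu0 : 0 < u := by rw [hu]; exact div_pos (by linarith) hn'
  have hw0 : 0 < w := by rw [hw]; exact div_pos (by exact_mod_cast hD0) hn'
  have hμ0 : 0 < μ := by rw [hμ]; positivity
  set G := fun q => graphOver Iᶜ (f q) with hG
  set 𝒞 := Finset.univ.image fun q => graphOver I (f q) with h𝒞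
  set 𝓑 : Finset (Finset (A × K)) := Finset.univ.powersetCard ℓ with h𝓑
  -- A class is named by the common graph of its members over `I`.
  set Ω := (𝒞 ×ˢ 𝓑).filter fun ω => ∃ q, graphOver I (f q) = ω.1 ∧ Disjoint ω.2 (G q) with hΩ
  have hmax : ∀ ω : Finset (A × K) × Finset (A × K), ∃ q, ω ∈ Ω →
      graphOver I (f q) = ω.1 ∧ Disjoint ω.2 (G q) ∧
        ∀ q', graphOver I (f q') = ω.1 → Disjoint ω.2 (G q') → r (ω.2 ∪ G q') ≤ r (ω.2 ∪ G q) := by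
    intro ω
    by_cases hω : ω ∈ Ω
    · obtain ⟨q₁, h1, h2⟩ := (Finset.mem_filter.1 hω).2
      obtain ⟨q, hq, hqmax⟩ := Finset.exists_max_image
        (Finset.univ.filter fun q => graphOver I (f q) = ω.1 ∧ Disjoint ω.2 (G q))
        (fun q => r (ω.2 ∪ G q)) ⟨q₁, by simp [h1, h2]⟩
      have hq' := (Finset.mem_filter.1 hq).2
      exact ⟨q, fun _ => ⟨hq'.1, hq'.2, fun q' h1' h2' => hqmax q' (by simp [h1', h2'])⟩⟩
    · exact ⟨Classical.arbitrary ι, fun h => absurd h hω⟩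
  choose lead hlead using hmax
  set top := fun ω : Finset (A × K) × Finset (A × K) => ω.2 ∪ G (lead ω) with htop
  have hmem : ∀ ω ∈ Ω, ω.2.card = ℓ := by
    intro ω hω
    have := (Finset.mem_product.1 (Finset.mem_filter.1 hω).1).2
    exact (Finset.mem_powersetCard.1 this).2
  refine ⟨Ω.image top, ?_, ?_⟩
  · intro γ hγ
    obtain ⟨ω, hω, rfl⟩ := Finset.mem_image.1 hγ
    obtain ⟨h1, h2, h3⟩ := hlead ω hω
    refine ⟨lead ω, ω.2, hmem ω hω, h2, rfl, fun q hq hd => h3 q ?_ hd⟩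
    rw [← h1, graphOver_eq_iff]
    exact fun i hi => (hq i hi).symm
  · have hΩlow : (Fintype.card K : ℝ) ^ I.card * (n.choose ℓ * μ) ≤ Ω.card * (4 + 8 * μ) := by
      have e1 : Ω.card = ∑ a ∈ 𝒞,
          (𝓑.filter fun b => ∃ q, graphOver I (f q) = a ∧ Disjoint b (G q)).card := by
        simp only [hΩ, Finset.card_filter, Finset.sum_product]
      rw [e1, Nat.cast_sum, Finset.sum_mul, ← Nat.cast_pow,
        ← hf.card_image_graphOver I hI, ← nsmul_eq_mul]
      refine Finset.card_nsmul_le_sum _ _ _ fun a ha => ?_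
      obtain ⟨q₀, _, rfl⟩ := Finset.mem_image.1 ha
      have := hf.choose_mul_le_card I hI q₀ hn hn0 ht hℓ hu hμ hu2 hlow
      refine this.trans (le_of_eq ?_)
      congr 3
      refine Finset.filter_congr fun b _ => exists_congr fun q => and_congr_left fun _ => ?_
      rw [graphOver_eq_iff]
      exact ⟨fun h i hi => (h i hi).symm, fun h i hi => (h i hi).symm⟩
    -- For a fixed `γ`, the function `lead ω` determines `ω`: its graph over `I` gives the class,
    -- and removing its graph over `Iᶜ` from `γ` gives `b`.
    have hΩup : (Ω.card : ℝ) ≤ ∑ γ ∈ Ω.image top,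
        ((Finset.univ.filter fun q => G q ⊆ γ).card : ℝ) := by
      rw [Finset.card_eq_sum_card_image top Ω]
      push_cast
      refine Finset.sum_le_sum fun γ _ => ?_
      rw [Nat.cast_le]
      refine Finset.card_le_card_of_injOn lead ?_ ?_
      · intro ω hω
        obtain ⟨hω, rfl⟩ := Finset.mem_filter.1 (Finset.mem_coe.1 hω)
        simp [htop, Finset.subset_union_right]
      · intro ω hω ω' hω' heq
        obtain ⟨hω, h1⟩ := Finset.mem_filter.1 (Finset.mem_coe.1 hω)
        obtain ⟨hω', h1'⟩ := Finset.mem_filter.1 (Finset.mem_coe.1 hω')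
        obtain ⟨h2, h3, _⟩ := hlead ω hω
        obtain ⟨h2', h3', _⟩ := hlead ω' hω'
        refine Prod.ext (by rw [← h2, ← h2', heq]) ?_
        have e1 : ω.2 = γ \ G (lead ω) := by
          rw [← h1, htop]; exact (Finset.union_sdiff_cancel_right h3).symm
        have e2 : ω'.2 = γ \ G (lead ω') := by
          rw [← h1', htop]; exact (Finset.union_sdiff_cancel_right h3').symm
        rw [e1, e2, heq]
    have hLsub : Ω.image top ⊆ Finset.univ.powersetCard D := by
      intro γ hγ
      obtain ⟨ω, hω, rfl⟩ := Finset.mem_image.1 hγ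
      rw [Finset.mem_powersetCard]
      refine ⟨Finset.subset_univ _, ?_⟩
      rw [htop, Finset.card_union_of_disjoint (hlead ω hω).2.1, hmem ω hω, hG, card_graphOver, hD,
        ht]
    have hCS := sq_sum_card_filter_le (Finset.univ.powersetCard D) (Ω.image top) hLsub
      Finset.univ fun γ q => G q ⊆ γ
    have hsecond : ∑ q : ι, ∑ q' : ι,
        (((Finset.univ.powersetCard D).filter fun γ => G q ⊆ γ ∧ G q' ⊆ γ).card : ℝ) ≤
          n.choose D * (M + M ^ 2 * 2) := by
      have e1 : ∀ q q',
          (((Finset.univ.powersetCard D).filter fun γ => G q ⊆ γ ∧ G q' ⊆ γ).card : ℝ) ≤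
          n.choose D * w ^ (G q ∪ G q').card := by
        intro q q'
        have : ∀ γ, (G q ⊆ γ ∧ G q' ⊆ γ) ↔ G q ∪ G q' ⊆ γ :=
          fun γ => Finset.union_subset_iff.symm
        simp only [this]
        rw [card_filter_superset (hn ▸ hDn), ← hn, ← Nat.choose_symm hDn, hw]
        have h := choose_sub_le (Nat.sub_le n D) hn0 (G q ∪ G q').card
          (by rw [hn]; exact Finset.card_le_univ _)
        rwa [Nat.cast_sub hDn, sub_sub_cancel] at h
      -- With no prescribed values the class is the whole family, so `spread` also covers the sum
      -- over all pairs.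
      have hall : ∀ q₀ : ι, (Finset.univ.filter fun q => ∀ i ∈ (∅ : Finset A), f q₀ i = f q i) =
          Finset.univ := by simp
      have hιcard : ((Finset.univ : Finset ι).card : ℝ) = (Fintype.card K : ℝ) ^ e := by
        have := hf.card_mul (Classical.arbitrary ι) ∅ (by simp)
        rw [Finset.card_empty, pow_zero, mul_one] at this
        rw [← Nat.cast_pow, ← this]
        simp
      calc _ ≤ ∑ q : ι, ∑ q' : ι, n.choose D * w ^ (G q ∪ G q').card :=
            Finset.sum_le_sum fun q _ => Finset.sum_le_sum fun q' _ => e1 q q'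
        _ = n.choose D * ∑ q : ι, ∑ q' : ι, w ^ (G q ∪ G q').card := by
            simp only [← Finset.mul_sum]
        _ ≤ _ := by
            gcongr
            have := sum_pow_card_graphOver_union_le Finset.univ f Iᶜ hw0 hm fun q hq J hJ => by
              have := hf.spread ∅ (by simp) q q (by simp) J (by simp)
              rw [hall] at this
              convert this
            rw [← ht, hιcard, ← hM] at this
            refine this.trans ?_
            gcongr
    calc _ ≤ (Ω.card * (4 + 8 * μ)) ^ 2 := by gcongr
      _ = (Ω.card : ℝ) ^ 2 * (4 + 8 * μ) ^ 2 := by ring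
      _ ≤ _ := by
        gcongr
        refine le_trans ?_ (hCS.trans (by gcongr))
        gcongr

/-! ### Univariate interpolation, and derivatives of the Nisan–Wigderson polynomial. -/

/-- Lagrange interpolation makes evaluation on `J` surjective, so each fibre is a coset of a kernel
of dimension `e - #J`. -/
theorem card_filter_eval_mul {K : Type*} [Field K] [Fintype K] [DecidableEq K] {A : Type*}
    (pt : A ↪ K) (e : ℕ) (q : Polynomial.degreeLT K e) (J : Finset A) (hJ : J.card ≤ e) :
    (Finset.univ.filter fun q' : Polynomial.degreeLT K e =>
      ∀ i ∈ J, (q : Polynomial K).eval (pt i) = (q' : Polynomial K).eval (pt i)).card *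
        Fintype.card K ^ J.card = Fintype.card K ^ e := by
  classical
  let φ : Polynomial.degreeLT K e →ₗ[K] (J → K) :=
    LinearMap.pi fun i => (Polynomial.leval (pt i)).comp (Polynomial.degreeLT K e).subtype
  have hφ : ∀ (p : Polynomial.degreeLT K e) (i : J),
      φ p i = (p : Polynomial K).eval (pt i) := fun _ _ => rfl
  have hsurj : Function.Surjective φ := by
    intro v
    let g : A → K := fun i => if h : i ∈ J then v ⟨i, h⟩ else 0
    have hinj : Set.InjOn pt J := pt.injective.injOn
    have hdeg := Lagrange.degree_interpolate_lt (r := g) hinj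
    refine ⟨⟨Lagrange.interpolate J pt g, Polynomial.mem_degreeLT.2 (hdeg.trans_le ?_)⟩, ?_⟩
    · exact_mod_cast hJ
    · ext i
      rw [hφ]
      simp only
      rw [Lagrange.eval_interpolate_at_node g hinj i.2]
      simp [g]
  have hrank := LinearMap.finrank_range_add_finrank_ker φ
  rw [LinearMap.range_eq_top.2 hsurj, finrank_top, Module.finrank_fintype_fun_eq_card,
    Fintype.card_coe, LinearEquiv.finrank_eq (Polynomial.degreeLTEquiv K e),
    Module.finrank_fintype_fun_eq_card, Fintype.card_fin] at hrank
  have hker : (Finset.univ.filter fun q' : Polynomial.degreeLT K e =>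
      ∀ i ∈ J, (q : Polynomial K).eval (pt i) = (q' : Polynomial K).eval (pt i)).card =
        Fintype.card (LinearMap.ker φ) := by
    rw [← Fintype.card_subtype]
    refine Fintype.card_congr
      { toFun := fun p => ⟨p.1 - q, ?_⟩
        invFun := fun p => ⟨p.1 + q, ?_⟩
        left_inv := fun p => by simp
        right_inv := fun p => by simp }
    · rw [LinearMap.mem_ker, map_sub, sub_eq_zero]
      ext i
      rw [hφ, hφ]
      exact (p.2 i i.2).symm
    · intro i hi
      have h := congrFun (LinearMap.mem_ker.1 p.2) ⟨i, hi⟩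
      rw [hφ] at h
      simp only at h
      simp [h]
  rw [hker, Module.card_eq_pow_finrank (K := K), ← pow_add, add_comm, hrank]

theorem isInterpolating_eval {K : Type*} [Field K] [Fintype K] [DecidableEq K] {A : Type*}
    (pt : A ↪ K) (e : ℕ) :
    IsInterpolating (fun (q : Polynomial.degreeLT K e) i => (q : Polynomial K).eval (pt i)) e where
  card_mul q J hJ := card_filter_eval_mul pt e q J hJ
  eq_of_eqOn q q' J hJ h := by
    refine Subtype.ext (Polynomial.eq_of_degrees_lt_of_eval_index_eq J pt.injective.injOn ?_ ?_ h)
    · exact (Polynomial.mem_degreeLT.1 q.2).trans_le (by exact_mod_cast hJ)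
    · exact (Polynomial.mem_degreeLT.1 q'.2).trans_le (by exact_mod_cast hJ)

theorem partialDeriv_sum_prod_X {ι A K F : Type*} [Fintype ι] [Fintype A] [DecidableEq A]
    [DecidableEq K] [CommRing F] (f : ι → A → K) (I : Finset A) (q₀ : ι) :
    partialDeriv (multilinearExp (graphOver I (f q₀)))
        (∑ q, ∏ i, X (i, f q i) : MvPolynomial (A × K) F) =
      ∑ q, if ∀ i ∈ I, f q₀ i = f q i then
        monomial (multilinearExp (graphOver Iᶜ (f q))) 1 else 0 := by
  rw [partialDeriv_sum]
  refine Finset.sum_congr rfl fun q _ => ?_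
  have h1 : (∏ i, X (i, f q i) : MvPolynomial (A × K) F) =
      ∏ x ∈ graphOver Finset.univ (f q), X x := by
    rw [graphOver, Finset.prod_map]; rfl
  have h2 : graphOver I (f q₀) ⊆ graphOver Finset.univ (f q) ↔ ∀ i ∈ I, f q₀ i = f q i := by
    constructor
    · intro h i hi
      have := h (mem_graphOver.2 ⟨hi, rfl⟩ : (i, f q₀ i) ∈ graphOver I (f q₀))
      exact (mem_graphOver.1 this).2.symm
    · intro h x hx
      obtain ⟨hi, hx⟩ := mem_graphOver.1 hx
      exact mem_graphOver.2 ⟨Finset.mem_univ _, by rw [← hx, h _ hi]⟩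
  rw [h1, partialDeriv_prod_X]
  by_cases h : ∀ i ∈ I, f q₀ i = f q i
  · rw [if_pos (h2.2 h), if_pos h, prod_X_eq_monomial]
    congr 3
    rw [graphOver_eq_iff.2 h]
    ext ⟨i, y⟩
    simp only [Finset.mem_sdiff, mem_graphOver, Finset.mem_univ, true_and, Finset.mem_compl]
    tauto
  · rw [if_neg fun h' => h (h2.1 h'), if_neg h]

/-- The leading monomials of the shifted partial derivatives bound the evaluation rank. -/
theorem IsInterpolating.card_le_finrank {ι A K F : Type*} [Fintype ι] [Fintype A] [Fintype K]
    [DecidableEq A] [DecidableEq K] [Field F] {f : ι → A → K} {e k ℓ D : ℕ}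
    (hf : IsInterpolating f e) (he : e ≤ Fintype.card A) (I : Finset A) (hk : I.card = k)
    (hD : D = ℓ + Iᶜ.card) (r : Finset (A × K) → ℕ) (hr : Function.Injective r)
    (L : Finset (Finset (A × K)))
    (hL : ∀ γ ∈ L, ∃ (q₀ : ι) (b : Finset (A × K)), b.card = ℓ ∧
        Disjoint b (graphOver Iᶜ (f q₀)) ∧ b ∪ graphOver Iᶜ (f q₀) = γ ∧
        ∀ q, (∀ i ∈ I, f q₀ i = f q i) → Disjoint b (graphOver Iᶜ (f q)) →
          r (b ∪ graphOver Iᶜ (f q)) ≤ r γ)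
    (c : A × K → F) (S B : Finset (A × K → F))
    (hcover : ∀ h : Finset (A × K), h.card ≤ D →
      c + indicatorVec F h ∈ S ∨ c + indicatorVec F h ∈ B) :
    L.card ≤ Gam k ℓ S (∑ q, ∏ i, X (i, f q i) : MvPolynomial (A × K) F) + B.card := by
  classical
  set P : MvPolynomial (A × K) F := ∑ q, ∏ i, X (i, f q i) with hP
  have hex : ∀ γ : Finset (A × K), ∃ Q : MvPolynomial (A × K) F, γ ∈ L →
      γ.card = D ∧ Q ∈ shiftedPartials k ℓ P ∧ Q.totalDegree ≤ D ∧
      coeff (multilinearExp γ) Q ≠ 0 ∧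
      ∀ γ', r γ < r γ' → coeff (multilinearExp γ') Q = 0 := by
    intro γ
    by_cases hγ : γ ∈ L
    swap
    · exact ⟨0, fun h => absurd h hγ⟩
    obtain ⟨q₀, b, hb, hdisj, hunion, hmax⟩ := hL γ hγ
    set Q := monomial (multilinearExp b) 1 *
      partialDeriv (multilinearExp (graphOver I (f q₀))) P with hQ
    have hQsum : Q = ∑ q, if ∀ i ∈ I, f q₀ i = f q i then
        monomial (multilinearExp b + multilinearExp (graphOver Iᶜ (f q))) 1 else 0 := by
      rw [hQ, hP, partialDeriv_sum_prod_X, Finset.mul_sum]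
      refine Finset.sum_congr rfl fun q _ => ?_
      split_ifs
      · rw [monomial_mul, one_mul]
      · rw [mul_zero]
    have hcoeff : ∀ γ', coeff (multilinearExp γ') Q = ∑ q, if (∀ i ∈ I, f q₀ i = f q i) ∧
        Disjoint b (graphOver Iᶜ (f q)) ∧ b ∪ graphOver Iᶜ (f q) = γ' then 1 else 0 := by
      intro γ'
      rw [hQsum, coeff_sum]
      refine Finset.sum_congr rfl fun q _ => ?_
      by_cases h : ∀ i ∈ I, f q₀ i = f q i
      · rw [if_pos h, coeff_monomial]
        simp only [multilinearExp_add_eq]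
        exact if_congr ⟨fun h' => ⟨h, h'⟩, fun h' => h'.2⟩ rfl rfl
      · rw [if_neg h, if_neg fun h' => h h'.1, coeff_zero]
    refine ⟨Q, fun _ => ⟨?_, ⟨multilinearExp (graphOver I (f q₀)), multilinearExp b, ?_, ?_, rfl⟩,
      ?_, ?_, ?_⟩⟩
    · rw [← hunion, Finset.card_union_of_disjoint hdisj, hb, card_graphOver, hD]
    · rw [degree_multilinearExp, card_graphOver, hk]
    · rw [degree_multilinearExp, hb]
    · rw [hQsum]
      refine totalDegree_finsetSum_le fun q _ => ?_
      split_ifs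
      · refine (totalDegree_monomial _ one_ne_zero).trans_le (le_of_eq ?_)
        change (multilinearExp b + multilinearExp (graphOver Iᶜ (f q))).degree = D
        rw [map_add, degree_multilinearExp, degree_multilinearExp, hb, card_graphOver, hD]
      · simp
    -- The leading coefficient is exactly `1`, hence nonzero in every characteristic: a term with
    -- the same monomial agrees with `q₀` on `Iᶜ` as well as on `I`, and `e ≤ Fintype.card A` forces
    -- `q = q₀`.
    · rw [hcoeff, Finset.sum_eq_single q₀]
      · rw [if_pos ⟨fun _ _ => rfl, hdisj, hunion⟩]
        exact one_ne_zero
      · rintro q - hq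
        rw [if_neg]
        rintro ⟨h1, h2, h3⟩
        refine hq (hf.eq_of_eqOn q q₀ Finset.univ (by simpa using he) fun i _ => ?_)
        by_cases hi : i ∈ I
        · exact (h1 i hi).symm
        · have h4 : graphOver Iᶜ (f q) = graphOver Iᶜ (f q₀) := by
            rw [← Finset.union_sdiff_cancel_left h2, h3, ← hunion,
              Finset.union_sdiff_cancel_left hdisj]
          exact graphOver_eq_iff.1 h4 i (Finset.mem_compl.2 hi)
      · simp
    · intro γ' hlt
      rw [hcoeff]
      refine Finset.sum_eq_zero fun q _ => if_neg ?_
      rintro ⟨h1, h2, rfl⟩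
      exact absurd (hmax q h1 h2) (not_le.2 hlt)
  choose Q hQ using hex
  exact card_le_finrank_span_add r hr D L (fun γ h => (hQ γ h).1) _ Q (fun γ h => (hQ γ h).2.1)
    (fun γ h => (hQ γ h).2.2.1) (fun γ h => (hQ γ h).2.2.2.1)
    (fun γ h γ' _ hlt => (hQ γ h).2.2.2.2 γ' hlt) c S B hcover

/-! ### Hamming balls and averaging over translates. -/

theorem card_filter_card_le {σ : Type*} [Fintype σ] [DecidableEq σ] {D : ℕ}
    (hD : 2 * D ≤ Fintype.card σ) :
    (Finset.univ.filter fun h : Finset σ => h.card ≤ D).card ≤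
      (D + 1) * (Fintype.card σ).choose D := by
  have hsub : (Finset.univ.filter fun h : Finset σ => h.card ≤ D) ⊆
      (Finset.range (D + 1)).biUnion fun j => Finset.univ.powersetCard j := by
    intro h hh
    simp only [Finset.mem_filter_univ] at hh
    simp only [Finset.mem_biUnion, Finset.mem_range, Finset.mem_powersetCard]
    exact ⟨h.card, by omega, Finset.subset_univ _, rfl⟩
  have hmono : ∀ j D : ℕ, j ≤ D → 2 * D ≤ Fintype.card σ →
      (Fintype.card σ).choose j ≤ (Fintype.card σ).choose D := by
    intro j D hj
    induction D, hj using Nat.le_induction with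
    | base => exact fun _ => le_rfl
    | succ i hi ih =>
      exact fun h => (ih (by omega)).trans (Nat.choose_le_succ_of_lt_half_left (by omega))
  refine (Finset.card_le_card hsub).trans (Finset.card_biUnion_le.trans ?_)
  refine (Finset.sum_le_card_nsmul _ _ ((Fintype.card σ).choose D) fun j hj => ?_).trans ?_
  · rw [Finset.card_powersetCard, Finset.card_univ]
    exact hmono j D (by have := Finset.mem_range.1 hj; omega) hD
  · simp

/-- Some translate of the Hamming ball of radius `D` meets `E` in at most the average number of
points. -/
theorem exists_translate {σ F : Type*} [Fintype σ] [DecidableEq σ] [Field F] [Fintype F]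
    (D : ℕ) (E : Set (σ → F)) :
    ∃ (c : σ → F) (S B : Finset (σ → F)),
      (S : Set (σ → F)) ⊆ ((fun h => c + h) '' hypercube σ F) \ E ∧
      (∀ h : Finset σ, h.card ≤ D → c + indicatorVec F h ∈ S ∨ c + indicatorVec F h ∈ B) ∧
      B.card * Fintype.card F ^ Fintype.card σ ≤
        E.ncard * (Finset.univ.filter fun h : Finset σ => h.card ≤ D).card := by
  classical
  set H := Finset.univ.filter fun h : Finset σ => h.card ≤ D with hH
  have hcount : ∑ c : σ → F, (H.filter fun h => c + indicatorVec F h ∈ E).card =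
      E.ncard * H.card := by
    have e3 := Finset.sum_card_bipartiteAbove_eq_sum_card_bipartiteBelow
      (s := (Finset.univ : Finset (σ → F))) (t := H) (fun c h => c + indicatorVec F h ∈ E)
    simp only [Finset.bipartiteAbove, Finset.bipartiteBelow] at e3
    rw [e3, mul_comm, ← smul_eq_mul]
    refine Finset.sum_const_nat fun h _ => ?_
    rw [Set.ncard_eq_toFinset_card']
    refine Finset.card_bij' (fun c _ => c + indicatorVec F h) (fun c _ => c - indicatorVec F h)
      ?_ ?_ (by simp) (by simp)
    · intro c hc; simpa using hc
    · intro c hc; simpa using hc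
  obtain ⟨c, -, hc⟩ : ∃ c ∈ (Finset.univ : Finset (σ → F)),
      (H.filter fun h => c + indicatorVec F h ∈ E).card * Fintype.card F ^ Fintype.card σ ≤
        E.ncard * H.card := by
    by_contra! hcon
    have hlt := Finset.sum_lt_sum_of_nonempty (Finset.univ_nonempty (α := σ → F)) hcon
    rw [← Finset.sum_mul _ _ (Fintype.card F ^ Fintype.card σ), hcount, Finset.sum_const,
      Finset.card_univ, Fintype.card_fun, smul_eq_mul, mul_comm] at hlt
    exact lt_irrefl _ hlt
  set T := H.image fun h => c + indicatorVec F h with hT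
  refine ⟨c, T.filter fun x => x ∉ E, T.filter fun x => x ∈ E, ?_, ?_, ?_⟩
  · intro x hx
    obtain ⟨hx, hxE⟩ := Finset.mem_filter.1 (Finset.mem_coe.1 hx)
    obtain ⟨h, _, rfl⟩ := Finset.mem_image.1 hx
    refine ⟨⟨indicatorVec F h, fun i => ?_, rfl⟩, hxE⟩
    by_cases hi : i ∈ h <;> simp [indicatorVec, hi]
  · intro h hh
    have hmem : c + indicatorVec F h ∈ T := Finset.mem_image_of_mem _ (by simp [hH, hh])
    by_cases hE : c + indicatorVec F h ∈ E
    · exact Or.inr (Finset.mem_filter.2 ⟨hmem, hE⟩)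
    · exact Or.inl (Finset.mem_filter.2 ⟨hmem, hE⟩)
  · refine le_trans ?_ hc
    gcongr
    rw [hT, Finset.filter_image]
    exact Finset.card_image_le

/-! ### First consequences of the parameter constraints. -/

/-- The lower bounds on `d`, in terms of `A`, that the estimates below use. -/
structure IsLarge (A : ℝ) (d : ℕ) : Prop where
  one_le_log : 1 ≤ Real.log d
  eps_le : A * (Real.log d / √(d : ℝ)) ≤ 1 / 10
  sqrt_le : A * √(d : ℝ) ≤ d / 10
  log_lt : 18 * A * Real.log d < d
  hundred_le : 100 ≤ (d : ℝ)
  mul_le : 100 * A ≤ d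
  sq_le : 2 * A ^ 2 ≤ d

theorem eventually_isLarge (A : ℝ) (hA : 0 < A) : ∀ᶠ d : ℕ in Filter.atTop, IsLarge A d := by
  have hd : Filter.Tendsto (fun d : ℕ => (d : ℝ)) Filter.atTop Filter.atTop :=
    tendsto_natCast_atTop_atTop
  have hlog : Filter.Tendsto (fun d : ℕ => Real.log d) Filter.atTop Filter.atTop :=
    Real.tendsto_log_atTop.comp hd
  have hsqrt : Filter.Tendsto (fun d : ℕ => √(d : ℝ)) Filter.atTop Filter.atTop :=
    Real.tendsto_sqrt_atTop.comp hd
  have h1 : Filter.Tendsto (fun d : ℕ => Real.log d / √(d : ℝ)) Filter.atTop (nhds 0) := by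
    have := (isLittleO_log_rpow_atTop (r := 1 / 2) (by norm_num)).tendsto_div_nhds_zero.comp hd
    refine this.congr fun d => ?_
    simp [Real.sqrt_eq_rpow]
  have h2 : Filter.Tendsto (fun d : ℕ => Real.log d / (d : ℝ)) Filter.atTop (nhds 0) := by
    have := (isLittleO_log_rpow_atTop (r := 1) (by norm_num)).tendsto_div_nhds_zero.comp hd
    refine this.congr fun d => ?_
    simp
  filter_upwards [hlog.eventually_ge_atTop 1,
    h1.eventually_le_const (show (0 : ℝ) < 1 / 10 / A by positivity),
    hsqrt.eventually_ge_atTop (10 * A),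
    h2.eventually_lt_const (show (0 : ℝ) < 1 / (18 * A) by positivity),
    hd.eventually_ge_atTop 100, hd.eventually_ge_atTop (100 * A),
    hd.eventually_ge_atTop (2 * A ^ 2)] with d e1 e2 e3 e4 e5 e6 e7
  refine ⟨e1, ?_, ?_, ?_, e5, e6, e7⟩
  · rw [le_div_iff₀ hA] at e2
    linarith
  · have hs : √(d : ℝ) * √(d : ℝ) = d := Real.mul_self_sqrt (by positivity)
    nlinarith [Real.sqrt_nonneg (d : ℝ)]
  · have hdpos : (0 : ℝ) < d := by linarith
    rw [div_lt_div_iff₀ hdpos (by positivity)] at e4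
    linarith

namespace NWParams

variable {A : ℝ} {d m e k ℓ : ℕ} {ε : ℝ}

theorem hundred_mul_le (h : NWParams A d m e k ℓ ε) (hA : 0 < A) (hd : IsLarge A d) :
    100 * (d : ℝ) ≤ m := by
  refine le_trans ?_ h.m_lower
  rw [le_div_iff₀ hA]
  have := hd.mul_le
  have := hd.hundred_le
  nlinarith

theorem eps_pos (h : NWParams A d m e k ℓ ε) (hA : 0 < A) (hd : IsLarge A d) : 0 < ε := by
  refine lt_of_lt_of_le ?_ h.ε_lower
  have := hd.one_le_log
  have := hd.hundred_le
  positivity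

theorem eps_le (h : NWParams A d m e k ℓ ε) (hd : IsLarge A d) : ε ≤ 1 / 10 :=
  h.ε_upper.trans hd.eps_le

theorem sq_eps_mul_le (h : NWParams A d m e k ℓ ε) (hA : 0 < A) (hd : IsLarge A d) :
    ε ^ 2 * d ≤ A ^ 2 * Real.log d ^ 2 := by
  have h0 := h.eps_pos hA hd
  have hdpos : (0 : ℝ) < d := by have := hd.hundred_le; linarith
  calc ε ^ 2 * d ≤ (A * (Real.log d / √(d : ℝ))) ^ 2 * d := by
        gcongr
        exact h.ε_upper
    _ = A ^ 2 * Real.log d ^ 2 := by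
        rw [mul_pow, div_pow, Real.sq_sqrt hdpos.le]
        field_simp

theorem k_le_div_ten (h : NWParams A d m e k ℓ ε) (hd : IsLarge A d) : (k : ℝ) ≤ d / 10 :=
  h.k_upper.trans hd.sqrt_le

theorem k_lt (h : NWParams A d m e k ℓ ε) (hd : IsLarge A d) : k < d := by
  have h1 := h.k_le_div_ten hd
  have h2 := hd.hundred_le
  have : (k : ℝ) < d := by linarith
  exact_mod_cast this

theorem log_m_le (h : NWParams A d m e k ℓ ε) (hA : 0 < A) (hd : IsLarge A d) :
    Real.log m ≤ 3 * Real.log d := by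
  have hdpos : (0 : ℝ) < d := by have := hd.hundred_le; linarith
  have hm : (0 : ℝ) < m := by have := h.hundred_mul_le hA hd; linarith
  have h1 : (m : ℝ) ≤ (d : ℝ) ^ 3 := by
    refine h.m_upper.trans ?_
    have : A ≤ d := by have := hd.mul_le; linarith
    calc A * (d : ℝ) ^ 2 ≤ d * (d : ℝ) ^ 2 := by gcongr
      _ = _ := by ring
  calc Real.log m ≤ Real.log ((d : ℝ) ^ 3) := Real.log_le_log hm h1
    _ = 3 * Real.log d := by rw [Real.log_pow]; norm_num

theorem rpow_m_le (h : NWParams A d m e k ℓ ε) (hA : 0 < A) (hd : IsLarge A d) :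
    (m : ℝ) ^ A ≤ Real.exp (3 * A * Real.log d) := by
  have hm : (0 : ℝ) < m := by
    have := h.hundred_mul_le hA hd
    have := hd.hundred_le
    linarith
  rw [Real.rpow_def_of_pos hm, Real.exp_le_exp]
  have := h.log_m_le hA hd
  nlinarith

theorem one_le_rpow_m (h : NWParams A d m e k ℓ ε) (hA : 0 < A) (hd : IsLarge A d) :
    1 ≤ (m : ℝ) ^ A := by
  refine Real.one_le_rpow ?_ hA.le
  have := h.hundred_mul_le hA hd
  have := hd.hundred_le
  linarith

/-- Otherwise `m ^ (e - k) ≤ 1`, so `(2 / (1 + ε)) ^ (d - k)`, exponential in `d`, would be at most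
`m ^ A`, polynomial in `d`. -/
theorem k_le_e (h : NWParams A d m e k ℓ ε) (hA : 0 < A) (hd : IsLarge A d) : k ≤ e := by
  by_contra! hlt
  have hm : (1 : ℝ) ≤ m := by
    have := h.hundred_mul_le hA hd
    have := hd.hundred_le
    linarith
  have hε := h.eps_pos hA hd
  have hε' := h.eps_le hd
  have h1 : (m : ℝ) ^ ((e : ℝ) - k) ≤ 1 := by
    refine Real.rpow_le_one_of_one_le_of_nonpos hm ?_
    have : (e : ℝ) ≤ k := by exact_mod_cast hlt.le
    linarith
  have h2 := h.pow_e_lower.trans h1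
  have hm0 : (0 : ℝ) < m := by linarith
  rw [Real.rpow_neg hm0.le, inv_mul_le_iff₀ (by positivity), mul_one] at h2
  have h3 := h2.trans (h.rpow_m_le hA hd)
  rw [Real.rpow_def_of_pos (by positivity), Real.exp_le_exp] at h3
  have h4 : 1 / 3 ≤ Real.log (2 / (1 + ε)) := by
    have := Real.one_sub_inv_le_log_of_pos (show 0 < 2 / (1 + ε) by positivity)
    refine le_trans ?_ this
    rw [inv_div]
    linarith
  have h5 := h.k_le_div_ten hd
  have h6 := hd.log_lt
  have h7 := hd.hundred_le
  nlinarith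

/-- Otherwise `e - k ≥ A + d / 2`, and `m ≥ 100` makes `m ^ (e - k)` at least `m ^ A * 10 ^ d`,
against the upper bound `m ^ A * 2 ^ d`. -/
theorem e_le_d (h : NWParams A d m e k ℓ ε) (hA : 0 < A) (hd : IsLarge A d) : e ≤ d := by
  by_contra! hlt
  have hd100 := hd.hundred_le
  have hm : (100 : ℝ) ≤ m := by have := h.hundred_mul_le hA hd; linarith
  have hm0 : (0 : ℝ) < m := by linarith
  have hε := h.eps_pos hA hd
  have hk := h.k_le_div_ten hd
  have hkd : (k : ℝ) ≤ d := by linarith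
  have hA' := hd.mul_le
  have hed : (d : ℝ) ≤ e := by exact_mod_cast hlt.le
  have h1 : (m : ℝ) ^ ((e : ℝ) - k) ≤ (m : ℝ) ^ A * 2 ^ (d : ℝ) := by
    refine h.pow_e_upper.trans ?_
    gcongr
    calc (2 / (1 + ε)) ^ ((d : ℝ) - k) ≤ 2 ^ ((d : ℝ) - k) := by
          refine Real.rpow_le_rpow (by positivity) ?_ (by linarith)
          exact div_le_self (by norm_num) (by linarith)
      _ ≤ 2 ^ (d : ℝ) := by
          refine Real.rpow_le_rpow_of_exponent_le (by norm_num) ?_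
          have : (0 : ℝ) ≤ k := by positivity
          linarith
  have h2 : (m : ℝ) ^ A * (100 : ℝ) ^ ((d : ℝ) / 2) ≤ (m : ℝ) ^ ((e : ℝ) - k) := by
    calc (m : ℝ) ^ A * (100 : ℝ) ^ ((d : ℝ) / 2) ≤ (m : ℝ) ^ A * (m : ℝ) ^ ((d : ℝ) / 2) := by
          gcongr
      _ = (m : ℝ) ^ (A + (d : ℝ) / 2) := (Real.rpow_add hm0 _ _).symm
      _ ≤ _ := Real.rpow_le_rpow_of_exponent_le (by linarith) (by linarith)
  have h3 := le_of_mul_le_mul_left (h2.trans h1) (by positivity)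
  have h4 : (100 : ℝ) ^ ((d : ℝ) / 2) = 10 ^ (d : ℝ) := by
    rw [show (100 : ℝ) = 10 ^ (2 : ℝ) by norm_num, ← Real.rpow_mul (by norm_num)]
    congr 1
    ring
  rw [h4] at h3
  exact absurd h3 (not_le.2 (Real.rpow_lt_rpow (by norm_num) (by norm_num) (by linarith)))

theorem ell_le (h : NWParams A d m e k ℓ ε) (hd : IsLarge A d) :
    (ℓ : ℝ) ≤ (d : ℝ) * m / 2 * (1 - ε) := by
  have hε := h.eps_le hd
  have := Nat.floor_le (show 0 ≤ ((d * m : ℕ) : ℝ) / 2 * (1 - ε) by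
    have : 0 ≤ 1 - ε := by linarith
    positivity)
  rw [← h.shift] at this
  push_cast at this
  exact this

theorem lt_ell (h : NWParams A d m e k ℓ ε) : (d : ℝ) * m / 2 * (1 - ε) < ℓ + 1 := by
  have := Nat.lt_floor_add_one (((d * m : ℕ) : ℝ) / 2 * (1 - ε))
  rw [← h.shift] at this
  push_cast at this
  exact this

/-- The gap `ε * n / 2` between `ℓ` and `n / 2` exceeds the added degree, because `m * ε ≥ 2`.
Binomial coefficients thus increase up to the radius of the ball. -/
theorem two_mul_le (h : NWParams A d m e k ℓ ε) (hA : 0 < A) (hd : IsLarge A d) :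
    2 * (ℓ + (d - k)) ≤ d * m := by
  have h1 := h.ell_le hd
  have hd100 := hd.hundred_le
  have hm := h.hundred_mul_le hA hd
  have hdpos : (0 : ℝ) < d := by linarith
  have h2 : 2 ≤ m * ε := by
    have hs : √(d : ℝ) ≤ d := Real.sqrt_le_iff.2 ⟨hdpos.le, by nlinarith⟩
    have hs0 : 0 < √(d : ℝ) := Real.sqrt_pos.2 hdpos
    have hl : 1 / d / A ≤ ε := by
      refine le_trans ?_ h.ε_lower
      gcongr
      exact hd.one_le_log
    calc (2 : ℝ) ≤ (d : ℝ) ^ 2 / A * (1 / d / A) := by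
          rw [div_div, div_mul_div_comm, mul_one, le_div_iff₀ (by positivity)]
          have := hd.sq_le
          nlinarith
      _ ≤ m * ε := by
          gcongr
          exact h.m_lower
  have h3 : (2 : ℝ) * (ℓ + d) ≤ d * m := by nlinarith
  have h4 : 2 * (ℓ + d) ≤ d * m := by exact_mod_cast h3
  omega

end NWParams

/-! ### Estimates for the expected counts. -/

theorem exp_half_le_two : Real.exp (1 / 2) ≤ 2 := by
  have h1 : Real.exp (1 / 2) ^ 2 = Real.exp 1 := by
    rw [← Real.exp_nat_mul]; norm_num
  have h2 := Real.exp_one_lt_d9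
  nlinarith [Real.exp_pos (1 / 2)]

theorem one_add_pow_le_two {x : ℝ} {t : ℕ} (hx : 0 ≤ x) (h : t * x ≤ 1 / 2) :
    (1 + x) ^ t ≤ 2 := by
  calc (1 + x) ^ t ≤ Real.exp x ^ t := by
        gcongr
        linarith [Real.add_one_le_exp x]
    _ = Real.exp (t * x) := (Real.exp_nat_mul x t).symm
    _ ≤ Real.exp (1 / 2) := by gcongr
    _ ≤ 2 := exp_half_le_two

theorem half_le_one_sub_pow {x : ℝ} {t : ℕ} (hx : x ≤ 1) (h : t * x ≤ 1 / 2) :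
    1 / 2 ≤ (1 - x) ^ t := by
  have := one_add_mul_le_pow (a := -x) (by linarith) t
  rw [← sub_eq_add_neg] at this
  linarith

/-- Solves the two Cauchy–Schwarz bounds for the number `R` of leading monomials, with `Y = m ^ A`.
Here `4 + 8 * μ ≤ 20 * Y`. Since `M / (1 + 2 * M)` increases with `M`, it is at least a third of the
lower bound `Y⁻¹ * X ≤ 1`; the constant is `4800 = 3 * 4 * 20 ^ 2`. -/
theorem div_le_of_sq_le {N M μ X Y R Z : ℝ} (hN : 0 < N) (hX0 : 0 < X) (hX1 : X ≤ 1)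
    (hY : 1 ≤ Y) (hM : Y⁻¹ * X ≤ M) (hR0 : 0 ≤ R) (hμ0 : 0 ≤ μ) (hμ : μ ≤ 2 * Y)
    (hZ : N * M / 2 ≤ Z) (hR : Z ^ 2 ≤ R * (N * (M + M ^ 2 * 2)) * (4 + 8 * μ) ^ 2) :
    N * (X / (4800 * Y ^ 3)) ≤ R := by
  have hY0 : 0 < Y := by linarith
  have hM0 : 0 < M := lt_of_lt_of_le (by positivity) hM
  have h2 : (N * M / 2) ^ 2 ≤ R * (N * (M + M ^ 2 * 2)) * (20 * Y) ^ 2 := by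
    refine (pow_le_pow_left₀ (by positivity) hZ 2).trans (hR.trans ?_)
    refine mul_le_mul_of_nonneg_left (pow_le_pow_left₀ (by positivity) (by linarith) 2) ?_
    positivity
  have h3 : N * M ≤ R * (1 + 2 * M) * (1600 * Y ^ 2) := by
    refine le_of_mul_le_mul_right ?_ (show 0 < N * M / 4 by positivity)
    linarith [h2]
  set M₀ := Y⁻¹ * X with hM₀
  have hM₀1 : M₀ ≤ 1 := by
    rw [hM₀, inv_mul_le_iff₀ hY0]; linarith
  have hM₀0 : 0 < M₀ := by positivity
  have e1 : M₀ / 3 ≤ M / (1 + 2 * M) := by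
    rw [div_le_div_iff₀ (by norm_num) (by positivity)]
    nlinarith
  have e2 : N * (M / (1 + 2 * M)) ≤ R * (1600 * Y ^ 2) := by
    rw [← mul_div_assoc, div_le_iff₀ (by positivity)]
    linarith
  have e3 : N * (M₀ / 3) ≤ R * (1600 * Y ^ 2) :=
    (mul_le_mul_of_nonneg_left e1 hN.le).trans e2
  have e4 : N * (X / (4800 * Y ^ 3)) = N * (M₀ / 3) / (1600 * Y ^ 2) := by
    rw [hM₀]; field_simp; norm_num
  rw [e4, div_le_iff₀ (by positivity)]
  exact e3

namespace NWParams

variable {A : ℝ} {d m e k ℓ n t D : ℕ} {ε u w μ M : ℝ}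

theorem n_pos (h : NWParams A d m e k ℓ ε) (hA : 0 < A) (hd : IsLarge A d) (hn : n = d * m) :
    (0 : ℝ) < n := by
  have h1 := hd.hundred_le
  have h2 := h.hundred_mul_le hA hd
  rw [hn]
  push_cast
  nlinarith

theorem t_le (ht : t = d - k) : (t : ℝ) ≤ d := by
  rw [ht]
  exact_mod_cast Nat.sub_le d k

theorem one_le_t (h : NWParams A d m e k ℓ ε) (hd : IsLarge A d) (ht : t = d - k) :
    (1 : ℝ) ≤ t := by
  have := h.k_lt hd
  exact_mod_cast (by omega : 1 ≤ t)

theorem t_div_m_le (h : NWParams A d m e k ℓ ε) (hA : 0 < A) (hd : IsLarge A d)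
    (ht : t = d - k) : (t : ℝ) * (4 / m) ≤ 1 / 2 := by
  have h1 := h.hundred_mul_le hA hd
  have h2 := t_le ht
  have h3 := hd.hundred_le
  rw [← mul_div_assoc, div_le_iff₀ (by linarith)]
  linarith

theorem t_sq_div_n_le (h : NWParams A d m e k ℓ ε) (hA : 0 < A) (hd : IsLarge A d)
    (hn : n = d * m) (ht : t = d - k) : (t : ℝ) * (4 * (t / n)) ≤ 1 / 2 := by
  have h1 := h.t_div_m_le hA hd ht
  have h2 := t_le ht
  have h3 := hd.hundred_le
  have h4 := h.hundred_mul_le hA hd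
  refine le_trans ?_ h1
  gcongr
  rw [hn]
  push_cast
  rw [div_eq_mul_inv (4 : ℝ)]
  gcongr
  rw [div_le_iff₀ (by nlinarith), mul_comm (d : ℝ), inv_mul_cancel_left₀ (by linarith)]
  exact h2

theorem half_le_u (h : NWParams A d m e k ℓ ε) (hA : 0 < A) (hd : IsLarge A d)
    (hn : n = d * m) (hu : u = ((n : ℝ) - ℓ) / n) : 1 / 2 ≤ u := by
  have hn0 := h.n_pos hA hd hn
  have h1 := h.ell_le hd
  have h2 := h.eps_pos hA hd
  rw [hu, le_div_iff₀ hn0]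
  have h3 : (n : ℝ) = d * m := by rw [hn]; push_cast; ring
  rw [← h3] at h1
  nlinarith

theorem u_mul_le (h : NWParams A d m e k ℓ ε) (hA : 0 < A) (hd : IsLarge A d)
    (hn : n = d * m) (hu : u = ((n : ℝ) - ℓ) / n) : 2 / (1 + ε) * u ≤ 1 + 4 / m := by
  have hn0 := h.n_pos hA hd hn
  have h1 := h.lt_ell
  have h2 := h.eps_pos hA hd
  have h3 : (n : ℝ) = d * m := by rw [hn]; push_cast; ring
  have h4 := hd.hundred_le
  have h5 := h.hundred_mul_le hA hd
  have hm : (0 : ℝ) < m := by linarith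
  rw [← h3] at h1
  have h6 : u ≤ (1 + ε) / 2 + 1 / m := by
    have : u ≤ (1 + ε) / 2 + 1 / n := by
      rw [hu, div_le_iff₀ hn0, add_mul, one_div_mul_cancel hn0.ne']
      linarith
    refine this.trans ?_
    have hmn : (m : ℝ) ≤ n := by
      rw [h3]
      nlinarith
    gcongr
  calc 2 / (1 + ε) * u ≤ 2 / (1 + ε) * ((1 + ε) / 2 + 1 / m) := by gcongr
    _ = 1 + 2 / (1 + ε) * (1 / m) := by field_simp
    _ ≤ 1 + 4 * (1 / m) := by
      gcongr
      rw [div_le_iff₀ (by linarith)]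
      linarith
    _ = 1 + 4 / m := by ring

theorem le_w (h : NWParams A d m e k ℓ ε) (hA : 0 < A) (hd : IsLarge A d)
    (hn : n = d * m) (ht : t = d - k) (hD : D = ℓ + t) (hw : w = (D : ℝ) / n) :
    (1 - ε) / 2 ≤ w := by
  have hn0 := h.n_pos hA hd hn
  have h1 := h.lt_ell
  have h2 := h.one_le_t hd ht
  have h3 : (n : ℝ) = d * m := by rw [hn]; push_cast; ring
  rw [← h3] at h1
  -- Rounding down costs `ℓ` less than `1`, which `t ≥ 1` makes up for.
  rw [hw, hD, le_div_iff₀ hn0]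
  push_cast
  linarith

theorem quarter_le_w (h : NWParams A d m e k ℓ ε) (hA : 0 < A) (hd : IsLarge A d)
    (hn : n = d * m) (ht : t = d - k) (hD : D = ℓ + t) (hw : w = (D : ℝ) / n) : 1 / 4 ≤ w := by
  have h1 := h.le_w hA hd hn ht hD hw
  have h2 := h.eps_le hd
  linarith

theorem one_add_inv_pow_le (h : NWParams A d m e k ℓ ε) (hA : 0 < A) (hd : IsLarge A d)
    (ht : t = d - k) {x : ℝ} (hx : 1 / 4 ≤ x) : (1 + x⁻¹ / m) ^ t ≤ 2 := by
  refine one_add_pow_le_two (by positivity) (le_trans ?_ (h.t_div_m_le hA hd ht))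
  gcongr
  rw [inv_le_comm₀ (by linarith) (by norm_num)]
  linarith

theorem choose_mul_u_pow_le (h : NWParams A d m e k ℓ ε) (hA : 0 < A) (hd : IsLarge A d)
    (hn : n = d * m) (ht : t = d - k) (hu : u = ((n : ℝ) - ℓ) / n) :
    (n.choose ℓ : ℝ) * u ^ t ≤ 2 * (n - t).choose ℓ := by
  have hn0 := h.n_pos hA hd hn
  have hu2 := h.half_le_u hA hd hn hu
  have hsq := h.t_sq_div_n_le hA hd hn ht
  have ht1 := h.one_le_t hd ht
  have htn : 0 ≤ (t : ℝ) / n := by positivity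
  have h1 : 1 / 2 ≤ (1 - 2 * ((t : ℝ) / n)) ^ t :=
    half_le_one_sub_pow (by nlinarith) (by nlinarith)
  have h2 : u * (1 - 2 * ((t : ℝ) / n)) ≤ ((n : ℝ) - ℓ - t) / n := by
    rw [sub_div, ← hu]
    nlinarith
  have h3 : (1 - 2 * ((t : ℝ) / n)) ≥ 0 := by nlinarith
  have h4 := h.two_mul_le hA hd
  have h5 := le_choose_sub (n := n) (ℓ := ℓ) (t := t) (by omega) (by exact_mod_cast hn0)
  have h6 : u ^ t * (1 / 2) ≤ (((n : ℝ) - ℓ - t) / n) ^ t := by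
    calc u ^ t * (1 / 2) ≤ u ^ t * (1 - 2 * ((t : ℝ) / n)) ^ t := by gcongr
      _ = (u * (1 - 2 * ((t : ℝ) / n))) ^ t := (mul_pow _ _ _).symm
      _ ≤ _ := by gcongr
  calc (n.choose ℓ : ℝ) * u ^ t = 2 * (n.choose ℓ * (u ^ t * (1 / 2))) := by ring
    _ ≤ 2 * (n.choose ℓ * (((n : ℝ) - ℓ - t) / n) ^ t) := by gcongr
    _ ≤ _ := by gcongr

/-- Converts the count of `ℓ`-sets into the target `n.choose D`. Replacing `ℓ / n` by `w` in the
ratio bound costs a factor `2`, since `t ^ 2 / n` is small. -/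
theorem choose_mul_w_pow_le (h : NWParams A d m e k ℓ ε) (hA : 0 < A) (hd : IsLarge A d)
    (hn : n = d * m) (ht : t = d - k) (hD : D = ℓ + t) (hu : u = ((n : ℝ) - ℓ) / n)
    (hw : w = (D : ℝ) / n) : (n.choose D : ℝ) * w ^ t ≤ 2 * (n.choose ℓ * u ^ t) := by
  have hn0 := h.n_pos hA hd hn
  have hw4 := h.quarter_le_w hA hd hn ht hD hw
  have hsq := h.t_sq_div_n_le hA hd hn ht
  have ht1 := h.one_le_t hd ht
  have htn : 0 ≤ (t : ℝ) / n := by positivity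
  have h1 : 1 / 2 ≤ (1 - 4 * ((t : ℝ) / n)) ^ t :=
    half_le_one_sub_pow (by nlinarith) hsq
  have h2 : w * (1 - 4 * ((t : ℝ) / n)) ≤ (ℓ : ℝ) / n := by
    have : (ℓ : ℝ) / n = w - t / n := by
      rw [hw, hD]; push_cast; ring
    rw [this]
    nlinarith
  have h3 : (1 - 4 * ((t : ℝ) / n)) ≥ 0 := by nlinarith
  have h4 := h.two_mul_le hA hd
  have h5 : (n.choose D : ℝ) * (ℓ : ℝ) ^ t ≤ n.choose ℓ * ((n : ℝ) - ℓ) ^ t := by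
    rw [hD, ← Nat.cast_sub (by omega)]
    exact_mod_cast choose_add_mul_pow_le n ℓ t
  have h6 : w ^ t * (1 / 2) ≤ ((ℓ : ℝ) / n) ^ t := by
    calc w ^ t * (1 / 2) ≤ w ^ t * (1 - 4 * ((t : ℝ) / n)) ^ t := by gcongr
      _ = (w * (1 - 4 * ((t : ℝ) / n))) ^ t := (mul_pow _ _ _).symm
      _ ≤ _ := by gcongr
  calc (n.choose D : ℝ) * w ^ t = 2 * (n.choose D * (w ^ t * (1 / 2))) := by ring
    _ ≤ 2 * (n.choose D * ((ℓ : ℝ) / n) ^ t) := by gcongr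
    _ ≤ _ := by
      gcongr 2 * ?_
      rw [hu, div_pow, div_pow, ← mul_div_assoc, ← mul_div_assoc]
      gcongr

theorem mu_le (h : NWParams A d m e k ℓ ε) (hA : 0 < A) (hd : IsLarge A d)
    (hn : n = d * m) (ht : t = d - k) (hu : u = ((n : ℝ) - ℓ) / n)
    (hμ : μ = (m : ℝ) ^ (e - k) * u ^ t) : μ ≤ 2 * (m : ℝ) ^ A := by
  have hu2 := h.half_le_u hA hd hn hu
  have h1 := h.pow_e_upper
  have hε := h.eps_pos hA hd
  rw [← Nat.cast_sub (h.k_le_e hA hd), Real.rpow_natCast, ← Nat.cast_sub (h.k_lt hd).le, ← ht,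
    Real.rpow_natCast] at h1
  calc μ ≤ (m : ℝ) ^ A * (2 / (1 + ε)) ^ t * u ^ t := by
        rw [hμ]
        gcongr
    _ = (m : ℝ) ^ A * (2 / (1 + ε) * u) ^ t := by rw [mul_pow]; ring
    _ ≤ (m : ℝ) ^ A * (1 + 4 / m) ^ t := by
        gcongr
        exact h.u_mul_le hA hd hn hu
    _ ≤ (m : ℝ) ^ A * 2 := by
        gcongr
        exact one_add_pow_le_two (by positivity) (h.t_div_m_le hA hd ht)
    _ = _ := mul_comm _ _

/-- The lower bounds on `m ^ k`, `m ^ (e - k)` and `w` combine as `(1 + ε) ^ 2 * (2 / (1 + ε)) * ((1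
- ε) / 2) = 1 - ε ^ 2`. This is where `m ^ k ≥ (1 + ε) ^ (2 * (d - k))` enters. -/
theorem le_M (h : NWParams A d m e k ℓ ε) (hA : 0 < A) (hd : IsLarge A d)
    (hn : n = d * m) (ht : t = d - k) (hD : D = ℓ + t) (hw : w = (D : ℝ) / n)
    (hM : M = (m : ℝ) ^ e * w ^ t) :
    ((m : ℝ) ^ A)⁻¹ * Real.exp (-(2 * A ^ 2 * Real.log d ^ 2)) ≤ M := by
  have hwl := h.le_w hA hd hn ht hD hw
  have hε := h.eps_pos hA hd
  have hε' := h.eps_le hd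
  have hke := h.k_le_e hA hd
  have hd100 := hd.hundred_le
  have hm0 : (0 : ℝ) < m := by have := h.hundred_mul_le hA hd; linarith
  have h1 := h.pow_e_lower
  rw [← Nat.cast_sub hke, Real.rpow_natCast, ← Nat.cast_sub (h.k_lt hd).le, ← ht,
    Real.rpow_natCast, Real.rpow_neg hm0.le] at h1
  have h2 := h.pow_k
  rw [← Nat.cast_sub (h.k_lt hd).le, ← ht, Real.rpow_natCast] at h2
  have h2' : ((1 + ε) ^ 2) ^ t ≤ (m : ℝ) ^ k := by
    rw [← pow_mul]
    refine le_trans (le_of_eq ?_) h2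
    rw [← Real.rpow_natCast]
    push_cast
    rfl
  have hA1 : 0 < (m : ℝ) ^ A := by positivity
  have h3 : Real.exp (-(2 * A ^ 2 * Real.log d ^ 2)) ≤ (1 - ε ^ 2) ^ t := by
    have e1 : Real.exp (-(2 * ε ^ 2)) ≤ 1 - ε ^ 2 := by
      have hpos : 0 < 1 - ε ^ 2 := by nlinarith
      rw [← Real.le_log_iff_exp_le hpos]
      refine le_trans ?_ (Real.one_sub_inv_le_log_of_pos hpos)
      have : (1 - ε ^ 2)⁻¹ ≤ 1 + 2 * ε ^ 2 := by
        have hx : 0 ≤ 1 - 2 * ε ^ 2 := by nlinarith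
        rw [inv_le_iff_one_le_mul₀ hpos]
        linarith [mul_nonneg (sq_nonneg ε) hx]
      linarith
    calc Real.exp (-(2 * A ^ 2 * Real.log d ^ 2)) ≤ Real.exp (t * -(2 * ε ^ 2)) := by
          rw [Real.exp_le_exp]
          have := h.sq_eps_mul_le hA hd
          have := t_le ht
          nlinarith [sq_nonneg ε]
      _ = Real.exp (-(2 * ε ^ 2)) ^ t := Real.exp_nat_mul _ _
      _ ≤ _ := by gcongr
  calc _ ≤ ((m : ℝ) ^ A)⁻¹ * (1 - ε ^ 2) ^ t := by gcongr
    _ = ((1 + ε) ^ 2) ^ t * (((m : ℝ) ^ A)⁻¹ * (2 / (1 + ε)) ^ t) * ((1 - ε) / 2) ^ t := by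
        rw [show (1 - ε ^ 2) = (1 + ε) ^ 2 * (2 / (1 + ε)) * ((1 - ε) / 2) by field_simp; ring,
          mul_pow, mul_pow]
        ring
    _ ≤ (m : ℝ) ^ k * (m : ℝ) ^ (e - k) * w ^ t := by
        have : 0 ≤ (1 - ε) / 2 := by linarith
        gcongr
    _ = M := by rw [hM, ← pow_add, Nat.add_sub_cancel' hke]

theorem mul_rpow_m_pow_le (h : NWParams A d m e k ℓ ε) (hA : 0 < A) (hd : IsLarge A d) :
    4800 * ((m : ℝ) ^ A) ^ 3 ≤ Real.exp ((9 * A + 13) * Real.log d ^ 2) := by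
  have hmexp := h.rpow_m_le hA hd
  have hL := hd.one_le_log
  set L := Real.log d
  have hLL : L ≤ L ^ 2 := by nlinarith
  have e1 : (4800 : ℝ) ≤ Real.exp (13 * L ^ 2) := by
    calc (4800 : ℝ) ≤ 2 ^ 13 := by norm_num
      _ ≤ Real.exp 1 ^ 13 := by
          have := Real.exp_one_gt_d9
          exact pow_le_pow_left₀ (by norm_num) (by linarith) 13
      _ = Real.exp 13 := by rw [← Real.exp_nat_mul]; norm_num
      _ ≤ _ := by
          rw [Real.exp_le_exp]
          linarith
  have e2 : ((m : ℝ) ^ A) ^ 3 ≤ Real.exp (9 * A * L ^ 2) := by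
    calc ((m : ℝ) ^ A) ^ 3 ≤ Real.exp (3 * A * L) ^ 3 :=
          pow_le_pow_left₀ (by positivity) hmexp 3
      _ = Real.exp (9 * A * L) := by
          rw [← Real.exp_nat_mul]; congr 1; push_cast; ring
      _ ≤ _ := by
          rw [Real.exp_le_exp]
          exact mul_le_mul_of_nonneg_left hLL (by positivity)
  calc 4800 * ((m : ℝ) ^ A) ^ 3 ≤ Real.exp (13 * L ^ 2) * Real.exp (9 * A * L ^ 2) :=
        mul_le_mul e1 e2 (by positivity) (Real.exp_pos _).le
    _ = _ := by rw [← Real.exp_add]; congr 1; ring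

theorem choose_mul_exp_le (h : NWParams A d m e k ℓ ε) (hA : 0 < A) (hd : IsLarge A d)
    (hn : n = d * m) (ht : t = d - k) (hD : D = ℓ + t) (hu : u = ((n : ℝ) - ℓ) / n)
    (hw : w = (D : ℝ) / n) (hμ : μ = (m : ℝ) ^ (e - k) * u ^ t)
    (hM : M = (m : ℝ) ^ e * w ^ t) {R : ℝ} (hR0 : 0 ≤ R)
    (hR : ((m : ℝ) ^ k * (n.choose ℓ * μ)) ^ 2 ≤
      R * (n.choose D * (M + M ^ 2 * 2)) * (4 + 8 * μ) ^ 2) :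
    (n.choose D : ℝ) * Real.exp (-(2 * A ^ 2 + 9 * A + 13) * Real.log d ^ 2) ≤ R := by
  have hke := h.k_le_e hA hd
  have hMle := h.le_M hA hd hn ht hD hw hM
  have hcw := h.choose_mul_w_pow_le hA hd hn ht hD hu hw
  have hu2 := h.half_le_u hA hd hn hu
  have hdm := h.two_mul_le hA hd
  have hN : (0 : ℝ) < n.choose D := by exact_mod_cast Nat.choose_pos (by omega)
  have hμ0 : 0 ≤ μ := by rw [hμ]; positivity
  have h1 : (n.choose D : ℝ) * M / 2 ≤ (m : ℝ) ^ k * (n.choose ℓ * μ) := by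
    have : (m : ℝ) ^ k * (n.choose ℓ * μ) = (m : ℝ) ^ e * (n.choose ℓ * u ^ t) := by
      rw [hμ, ← Nat.add_sub_cancel' hke, pow_add, Nat.add_sub_cancel' hke]
      ring
    rw [this, hM]
    have := mul_le_mul_of_nonneg_left hcw (show 0 ≤ (m : ℝ) ^ e by positivity)
    linarith
  have h2 := div_le_of_sq_le hN (Real.exp_pos _) (Real.exp_le_one_iff.2 (by
    have : 0 ≤ 2 * A ^ 2 * Real.log d ^ 2 := by positivity
    linarith)) (h.one_le_rpow_m hA hd) hMle hR0 hμ0 (h.mu_le hA hd hn ht hu hμ) h1 hR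
  refine le_trans ?_ h2
  calc (n.choose D : ℝ) * Real.exp (-(2 * A ^ 2 + 9 * A + 13) * Real.log d ^ 2)
      = n.choose D * (Real.exp (-(2 * A ^ 2 * Real.log d ^ 2)) /
          Real.exp ((9 * A + 13) * Real.log d ^ 2)) := by
        rw [← Real.exp_sub]; congr 2; ring
    _ ≤ _ := by
        gcongr
        · have := h.one_le_rpow_m hA hd
          positivity
        · exact h.mul_rpow_m_pow_le hA hd

end NWParams

/-! ### Assembly of the rank bound. -/

theorem NWParams.exists_rank_lower_bound {A : ℝ} {d m e k ℓ : ℕ} {ε : ℝ}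
    (h : NWParams A d m e k ℓ ε) (hA : 0 < A) (hd : IsLarge A d) {K : Type*} [Field K] [Fintype K]
    (hK : Fintype.card K = m) (pt : Fin d ↪ K) {F : Type*} [Field F] [Fintype F]
    (E : Set (Fin d × K → F)) :
    ∃ (c : Fin d × K → F) (S : Finset (Fin d × K → F)) (R b : ℕ),
      (S : Set (Fin d × K → F)) ⊆ ((fun h => c + h) '' hypercube (Fin d × K) F) \ E ∧
      R ≤ Gam k ℓ S (NW F pt e) + b ∧
      ((d * m).choose (ℓ + d - k) : ℝ) *
        Real.exp (-(2 * A ^ 2 + 9 * A + 13) * Real.log d ^ 2) ≤ R ∧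
      b * Fintype.card F ^ (d * m) ≤
        E.ncard * ((ℓ + d - k + 1) * (d * m).choose (ℓ + d - k)) := by
  classical
  have hkd := h.k_lt hd
  have hke := h.k_le_e hA hd
  have hed := h.e_le_d hA hd
  have h2D := h.two_mul_le hA hd
  have hDeq : ℓ + d - k = ℓ + (d - k) := Nat.add_sub_assoc hkd.le ℓ
  rw [hDeq]
  obtain ⟨n, hn⟩ : ∃ n, n = d * m := ⟨_, rfl⟩
  obtain ⟨t, ht⟩ : ∃ t, t = d - k := ⟨_, rfl⟩
  obtain ⟨D, hD⟩ : ∃ D, D = ℓ + t := ⟨_, rfl⟩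
  rw [← hn, ← ht, ← hD]
  rw [← hn, ← ht, ← hD] at h2D
  have hcard : Fintype.card (Fin d × K) = n := by simp [hn, hK]
  set I : Finset (Fin d) := Finset.univ.filter fun i => (i : ℕ) < k with hI
  have hIk : I.card = k := by
    rw [hI, Fin.card_filter_val_lt]; omega
  have hIc : Iᶜ.card = t := by rw [Finset.card_compl, hIk, Fintype.card_fin, ht]
  have hf := isInterpolating_eval pt e
  obtain ⟨c, S, B, hS, hcover, hB⟩ := exists_translate (σ := Fin d × K) D E
  -- Any enumeration will do: no compatibility with multiplication of monomials is needed.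
  let r : Finset (Fin d × K) → ℕ := fun s => (Fintype.equivFin _ s : ℕ)
  have hr : Function.Injective r := fun s s' hss =>
    (Fintype.equivFin _).injective (Fin.ext hss)
  have hn0 := h.n_pos hA hd hn
  obtain ⟨L, hL, hLcard⟩ := hf.exists_leading (ℓ := ℓ) (n := n) (t := t) (D := D) I
    (by omega) r hcard.symm (by exact_mod_cast hn0) hIc.symm hD (by omega) (by omega) (by omega)
    rfl rfl rfl rfl
    (by rw [hK]
        exact h.one_add_inv_pow_le hA hd ht (by linarith [h.half_le_u hA hd hn rfl]))
    (by rw [hK]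
        exact h.one_add_inv_pow_le hA hd ht (h.quarter_le_w hA hd hn ht hD rfl))
    (h.choose_mul_u_pow_le hA hd hn ht rfl)
  refine ⟨c, S, L.card, B.card, hS, ?_, ?_, ?_⟩
  · exact hf.card_le_finrank (by simpa using hed) I hIk (by rw [hD, hIc]) r hr L hL c S B hcover
  · rw [hIk, hK] at hLcard
    exact h.choose_mul_exp_le hA hd hn ht hD rfl rfl rfl rfl (by positivity) hLcard
  · rw [hcard] at hB
    refine hB.trans (Nat.mul_le_mul_left _ ?_)
    rw [← hcard]
    exact card_filter_card_le (by omega)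

theorem mainTheorem6 (A : ℝ) (hA : 0 < A) :
    ∃ C : ℝ, 0 < C ∧
      ∀ g : ℕ → ℝ,
        Filter.Tendsto (fun d : ℕ => g d / Real.log d ^ 2) Filter.atTop Filter.atTop →
        ∃ d₀ : ℕ, ∀ d : ℕ, d₀ ≤ d →
          ∀ (m e k ℓ : ℕ) (ε : ℝ), NWParams A d m e k ℓ ε →
          ∀ (K : Type*) [Field K] [Fintype K], Fintype.card K = m →
          ∀ (pt : Fin d ↪ K) (F : Type*) [Field F] [Fintype F]
            (E : Set (Fin d × K → F)),
            (E.ncard : ℝ) ≤ Real.exp (-g d) * (Fintype.card F : ℝ) ^ (d * m) →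
            ∃ (c : Fin d × K → F) (S : Finset (Fin d × K → F)),
              (S : Set (Fin d × K → F)) ⊆ ((fun h => c + h) '' hypercube (Fin d × K) F) \ E ∧
              ((d * m).choose (ℓ + d - k) : ℝ) * Real.exp (-C * Real.log d ^ 2) ≤
                ((evalMatrix k ℓ S (NW F pt e)).rank : ℝ) ∧
              ((d * m).choose (ℓ + d - k) : ℝ) * Real.exp (-C * Real.log d ^ 2) ≤
                (Gam k ℓ S (NW F pt e) : ℝ) := by
  set C₀ := 2 * A ^ 2 + 9 * A + 13 with hC₀
  refine ⟨C₀ + 1, by positivity, fun g hg => ?_⟩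
  obtain ⟨d₀, hd₀⟩ := Filter.eventually_atTop.1
    -- Of the `5`, a share of `4` absorbs `D + 1 ≤ d ^ 4`. The last `1` keeps the deleted points
    -- below half of the lower bound for `R`, and passing to that half is why the final constant is
    -- `C₀ + 1`.
    ((eventually_isLarge A hA).and (hg.eventually_ge_atTop (C₀ + 5)))
  refine ⟨d₀, fun d hdd m e k ℓ ε h K _ _ hK pt F _ _ E hE => ?_⟩
  obtain ⟨hd, hgd⟩ := hd₀ d hdd
  obtain ⟨c, S, R, b, hS, hRb, hR, hb⟩ := h.exists_rank_lower_bound hA hd hK pt E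
  refine ⟨c, S, hS, ?_⟩
  rw [rank_evalMatrix, and_self]
  have hL := hd.one_le_log
  have hdpos : (0 : ℝ) < d := by have := hd.hundred_le; linarith
  set N : ℝ := ((d * m).choose (ℓ + d - k) : ℝ)
  have hbR : (b : ℝ) ≤ Real.exp (-g d) * ((ℓ + d - k + 1 : ℕ) * N) := by
    have hq : (0 : ℝ) < (Fintype.card F : ℝ) ^ (d * m) := by
      have : (0 : ℝ) < Fintype.card F := by exact_mod_cast Fintype.card_pos
      positivity
    refine le_of_mul_le_mul_right ?_ hq
    have hb' : (b : ℝ) * (Fintype.card F : ℝ) ^ (d * m) ≤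
        E.ncard * ((ℓ + d - k + 1 : ℕ) * N) := by
      have := (Nat.cast_le (α := ℝ)).2 hb
      rwa [Nat.cast_mul, Nat.cast_pow, Nat.cast_mul, Nat.cast_mul] at this
    refine hb'.trans ((mul_le_mul_of_nonneg_right hE (by positivity)).trans (le_of_eq ?_))
    ring
  have hDle : ((ℓ + d - k + 1 : ℕ) : ℝ) ≤ Real.exp (4 * Real.log d ^ 2) := by
    have h1 := h.two_mul_le hA hd
    have h2 := h.k_lt hd
    have h3 : ℓ + d - k + 1 ≤ d * m := by omega
    calc ((ℓ + d - k + 1 : ℕ) : ℝ) ≤ d * m := by exact_mod_cast h3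
      _ ≤ d * (d * (d : ℝ) ^ 2) := by
          gcongr
          refine h.m_upper.trans ?_
          gcongr
          have := hd.mul_le
          linarith
      _ = Real.exp (Real.log d) ^ 4 := by rw [Real.exp_log hdpos]; ring
      _ = Real.exp (4 * Real.log d) := by rw [← Real.exp_nat_mul]; norm_num
      _ ≤ _ := by
          rw [Real.exp_le_exp]
          nlinarith
  have hg' : (C₀ + 5) * Real.log d ^ 2 ≤ g d := by
    rwa [le_div_iff₀ (by positivity)] at hgd
  set Λ := Real.log d ^ 2
  have hΛ : 1 ≤ Λ := by nlinarith
  have hN0 : 0 ≤ N := by positivity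
  have hb2 : (b : ℝ) ≤ N * Real.exp (-(C₀ + 1) * Λ) := by
    refine hbR.trans ?_
    calc Real.exp (-g d) * ((ℓ + d - k + 1 : ℕ) * N)
        ≤ Real.exp (-((C₀ + 5) * Λ)) * (Real.exp (4 * Λ) * N) := by gcongr
      _ = N * Real.exp (-(C₀ + 1) * Λ) := by
          rw [← mul_assoc, ← Real.exp_add, mul_comm]
          congr 2
          ring
  have hexp : 2 * Real.exp (-(C₀ + 1) * Λ) ≤ Real.exp (-C₀ * Λ) := by
    have h1 : Real.exp (-C₀ * Λ) = Real.exp Λ * Real.exp (-(C₀ + 1) * Λ) := by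
      rw [← Real.exp_add]; congr 1; ring
    rw [h1]
    gcongr
    have := Real.add_one_le_exp Λ
    linarith
  have hRb' : (R : ℝ) ≤ Gam k ℓ S (NW F pt e) + b := by exact_mod_cast hRb
  have := mul_le_mul_of_nonneg_left hexp hN0
  linarith
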